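/- Let $\mathfrak n$ be a two-step nilpotent real Lie algebra with a basis $Z_1,\dots,Z_{n-2d},Y_1,\dots,Y_d,X_1,\dots,X_d$ ($d\ge 1$) such that the $Z_k$ span the center of $\mathfrak n$, $[Y_i,Y_j]=[X_i,X_j]=0$ for all $i,j$, and some linear functional $f$ on $\mathfrak n$ satisfies: $f([v,\cdot])=0$ if and only if $v$ is central. Let $N=\exp\mathfrak n$ be the connected, simply connected Lie group of $\mathfrak n$, with Haar measure $dz\,dy\,dx$ in the coordinates $\exp(\sum_k z_kZ_k)\exp(\sum_j y_jY_j)\exp(\sum_j x_jX_j)$, and let $L$ be its left regular representation on $L^2(N)$, $(L(g)f)(n)=f(g^{-1}n)$. Identify $\lambda\in\mathbb R^{n-2d}$ with the linear functional on $\mathfrak n$ with $Z_k\mapsto\lambda_k$, $Y_j\mapsto 0$, $X_j\mapsto 0$. Let $B(\lambda)=(-\lambda([X_i,Y_j]))_{1\le i,j\le d}$, let $V(\lambda)=(\lambda([E_i,E_j]))_{1\le i,j\le 2d}$ with $(E_1,\dots,E_{2d})=(Y_1,\dots,Y_d,X_1,\dots,X_d)$, let $\Sigma=\{\lambda\in\mathbb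 R^{n-2d}:\det V(\lambda)\neq 0\}$, and let $d\mu(\lambda)=|\det B(\lambda)|\,d\lambda$ be the Plancherel measure on $\Sigma$. For $\lambda\in\Sigma$ let $\pi_\lambda$ be the representation of $N$ on $L^2(\mathbb R^d)$ given by $$\pi_\lambda\Big(\exp\big(\textstyle\sum z_kZ_k\big)\exp\big(\sum y_jY_j\big)\exp\big(\sum x_jX_j\big)\Big)F(t)=e^{2\pi i(\langle\lambda,z\rangle+\langle t,B(\lambda)y\rangle)}F(t-x).$$ Let $\mathcal P:L^2(N)\to\int_\Sigma^\oplus L^2(\mathbb R^d)\otimes L^2(\mathbb R^d)\,d\mu(\lambda)$ be the Plancherel transform, that is, the continuous extension of $f\mapsto\big(\int_N f(n)\pi_\lambda(n)\,dn\big)_{\lambda\in\Sigma}$ from $L^1(N)\cap L^2(N)$; here $L^2(\mathbb R^d)\otimes L^2(\mathbb R^d)$ is the space of Hilbert–Schmidt operators on $L^2(\mathbb R^d)$, and $v\otimes u$ is the operator $h\mapsto\langle h,u\rangle v$. Let $a=(a_1,\dots,a_{n-2d})$, $q=(q_1,\dots,q_d)$, $b=(b_1,\dots,b_d)$ have strictly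 positive entries, and let $$\Gamma_{a,q,b}=\Big\{\exp\Big(\sum_k\tfrac{m_k}{a_k}Z_k\Big)\exp\Big(\sum_j\tfrac{k_j}{q_j}Y_j\Big)\exp\Big(\sum_j\tfrac{n_j}{b_j}X_j\Big):m_k,k_j,n_j\in\mathbb Z\Big\}.$$ Let $\mathbf I\subseteq\{\lambda\in\Sigma:0\le\lambda_k\le a_k\text{ for all }k\}$ be measurable, let $\mathbf u\in L^2(\mathbb R^d)$ be a unit vector, and let $$\mathcal H=\mathcal P^{-1}\Big(\int_{\mathbf I}^\oplus L^2(\mathbb R^d)\otimes\mathbf u\;d\mu(\lambda)\Big).$$ If there exists $\eta\in L^2(N)$ such that $\{L(\gamma)\eta\}_{\gamma\in\Gamma_{a,q,b}}$ is a Parseval frame in $\mathcal H$ (that is, all $L(\gamma)\eta$ lie in $\mathcal H$ and $\sum_{\gamma}|\langle\psi,L(\gamma)\eta\rangle|^2=\|\psi\|^2$ for every $\psi\in\mathcal H$), then $$\mu(\mathbf I)\le(q_1\cdots q_d)(b_1\cdots b_d)(a_1\cdots a_{n-2d}).$$ -/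

import Mathlib

open MeasureTheory Matrix
open scoped ENNReal

noncomputable section

/-- The Lie bracket is two-step nilpotent: `[[x, y], z] = 0` for all `x, y, z`. -/
class TwoStepLie (𝔫 : Type*) [LieRing 𝔫] : Prop where
  lie_lie_eq_zero : ∀ x y z : 𝔫, ⁅⁅x, y⁆, z⁆ = 0

/-- The connected, simply connected Lie group `N = exp 𝔫` of a two-step nilpotent Lie algebra `𝔫`:
its underlying manifold is `𝔫` and `exp` is the identity chart. -/
@[ext] structure NilGroup (𝔫 : Type*) where
  /-- the exponential map -/
  exp ::
  /-- the logarithm, inverse of the exponential map -/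
  log : 𝔫

namespace NilGroup

variable {𝔫 : Type*} [LieRing 𝔫] [LieAlgebra ℝ 𝔫] [TwoStepLie 𝔫]

/-- The Baker-Campbell-Hausdorff law `exp v * exp w = exp (v + w + [v, w] / 2)`. -/
instance : Mul (NilGroup 𝔫) :=
  ⟨fun g h => exp (g.log + h.log + (1 / 2 : ℝ) • ⁅g.log, h.log⁆)⟩

instance : One (NilGroup 𝔫) := ⟨exp 0⟩

instance : Inv (NilGroup 𝔫) := ⟨fun g => exp (-g.log)⟩

theorem log_mul (g h : NilGroup 𝔫) :
    (g * h).log = g.log + h.log + (1 / 2 : ℝ) • ⁅g.log, h.log⁆ := rfl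

theorem lie_lie_right (x y z : 𝔫) : ⁅x, ⁅y, z⁆⁆ = 0 := by
  rw [← lie_skew, TwoStepLie.lie_lie_eq_zero, neg_zero]

instance : Group (NilGroup 𝔫) where
  mul_assoc a b c := by
    ext
    simp only [log_mul, lie_add, add_lie, lie_smul, smul_lie, TwoStepLie.lie_lie_eq_zero,
      lie_lie_right, smul_zero, add_zero, smul_add]
    abel
  one_mul a := by
    ext
    change (0 : 𝔫) + a.log + (1 / 2 : ℝ) • ⁅(0 : 𝔫), a.log⁆ = a.log
    simp
  mul_one a := by
    ext
    change a.log + (0 : 𝔫) + (1 / 2 : ℝ) • ⁅a.log, (0 : 𝔫)⁆ = a.log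
    simp
  inv_mul_cancel a := by
    ext
    change -a.log + a.log + (1 / 2 : ℝ) • ⁅-a.log, a.log⁆ = 0
    simp

/-- The topology of `N` is that of the finite-dimensional real vector space `𝔫`. -/
instance : TopologicalSpace (NilGroup 𝔫) := (moduleTopology ℝ 𝔫).induced log

instance : MeasurableSpace (NilGroup 𝔫) := borel _

instance : BorelSpace (NilGroup 𝔫) := ⟨rfl⟩

end NilGroup

/-- Coordinates `(z, y, x)` with `z ∈ ℝ^m`, `y, x ∈ ℝ^d`. -/
abbrev Coords (m d : ℕ) : Type := (Fin m → ℝ) × (Fin d → ℝ) × (Fin d → ℝ)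

/-- A basis `Z_1, …, Z_m, Y_1, …, Y_d, X_1, …, X_d` of the Lie algebra `𝔫` such that the `Z_k` span
the center, the `Y_j` commute with each other, the `X_j` commute with each other, and some linear
functional on `𝔫` has the center as its radical (so that `exp 𝔫` is square integrable modulo
its center). -/
structure AdaptedBasis (𝔫 : Type*) [LieRing 𝔫] [LieAlgebra ℝ 𝔫] (m d : ℕ) where
  basis : Module.Basis (Fin m ⊕ (Fin d ⊕ Fin d)) ℝ 𝔫
  span_Z : Submodule.span ℝ (Set.range fun k => basis (Sum.inl k))
    = (LieAlgebra.center ℝ 𝔫).toSubmodule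
  lie_Y : ∀ i j, ⁅basis (Sum.inr (Sum.inl i)), basis (Sum.inr (Sum.inl j))⁆ = 0
  lie_X : ∀ i j, ⁅basis (Sum.inr (Sum.inr i)), basis (Sum.inr (Sum.inr j))⁆ = 0
  exists_flat : ∃ f : Module.Dual ℝ 𝔫,
    ∀ v : 𝔫, (∀ w : 𝔫, f ⁅v, w⁆ = 0) ↔ v ∈ LieAlgebra.center ℝ 𝔫

namespace AdaptedBasis

variable {𝔫 : Type*} [LieRing 𝔫] [LieAlgebra ℝ 𝔫] {m d : ℕ} (e : AdaptedBasis 𝔫 m d)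

def Z (k : Fin m) : 𝔫 := e.basis (Sum.inl k)

def Y (j : Fin d) : 𝔫 := e.basis (Sum.inr (Sum.inl j))

def X (j : Fin d) : 𝔫 := e.basis (Sum.inr (Sum.inr j))

/-! ### The coordinates `(z, y, x) ↦ exp (∑ z_k Z_k) exp (∑ y_j Y_j) exp (∑ x_j X_j)` on `N` -/

/-- `∑ z_k Z_k` -/
def zVec (z : Fin m → ℝ) : 𝔫 := ∑ k, z k • e.Z k

/-- `∑ y_j Y_j` -/
def yVec (y : Fin d → ℝ) : 𝔫 := ∑ j, y j • e.Y j

/-- `∑ x_j X_j` -/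
def xVec (x : Fin d → ℝ) : 𝔫 := ∑ j, x j • e.X j

/-- The element `exp (∑ z_k Z_k) exp (∑ y_j Y_j) exp (∑ x_j X_j)` of `N`. -/
def ofCoords (p : Coords m d) : NilGroup 𝔫 :=
  NilGroup.exp (e.zVec p.1) * NilGroup.exp (e.yVec p.2.1) * NilGroup.exp (e.xVec p.2.2)

def zRepr (v : 𝔫) (k : Fin m) : ℝ := e.basis.repr v (Sum.inl k)

def yRepr (v : 𝔫) (j : Fin d) : ℝ := e.basis.repr v (Sum.inr (Sum.inl j))

def xRepr (v : 𝔫) (j : Fin d) : ℝ := e.basis.repr v (Sum.inr (Sum.inr j))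

/-- The coordinates of an element of `N`: the inverse of `ofCoords`. -/
def toCoords (n : NilGroup 𝔫) : Coords m d :=
  (e.zRepr (n.log - (1 / 2 : ℝ) • ⁅e.yVec (e.yRepr n.log), e.xVec (e.xRepr n.log)⁆),
    e.yRepr n.log, e.xRepr n.log)

theorem zRepr_add (v w : 𝔫) : e.zRepr (v + w) = e.zRepr v + e.zRepr w := by
  ext; simp [zRepr]
theorem yRepr_add (v w : 𝔫) : e.yRepr (v + w) = e.yRepr v + e.yRepr w := by
  ext; simp [yRepr]
theorem xRepr_add (v w : 𝔫) : e.xRepr (v + w) = e.xRepr v + e.xRepr w := by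
  ext; simp [xRepr]
theorem zVec_add (z z' : Fin m → ℝ) : e.zVec (z + z') = e.zVec z + e.zVec z' := by
  simp [zVec, add_smul, Finset.sum_add_distrib]
theorem yVec_add (z z' : Fin d → ℝ) : e.yVec (z + z') = e.yVec z + e.yVec z' := by
  simp [yVec, add_smul, Finset.sum_add_distrib]
theorem xVec_add (z z' : Fin d → ℝ) : e.xVec (z + z') = e.xVec z + e.xVec z' := by
  simp [xVec, add_smul, Finset.sum_add_distrib]

theorem decomp (v : 𝔫) : e.zVec (e.zRepr v) + e.yVec (e.yRepr v) + e.xVec (e.xRepr v) = v := by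
  have h := e.basis.sum_repr v
  rw [Fintype.sum_sum_type, Fintype.sum_sum_type, ← add_assoc] at h
  exact h

theorem repr_zVec (z : Fin m → ℝ) :
    e.zRepr (e.zVec z) = z ∧ e.yRepr (e.zVec z) = 0 ∧ e.xRepr (e.zVec z) = 0 := by
  refine ⟨?_, ?_, ?_⟩ <;> ext i <;>
    simp [zVec, Z, zRepr, yRepr, xRepr, Finsupp.single_apply]

theorem repr_yVec (y : Fin d → ℝ) :
    e.zRepr (e.yVec y) = 0 ∧ e.yRepr (e.yVec y) = y ∧ e.xRepr (e.yVec y) = 0 := by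
  refine ⟨?_, ?_, ?_⟩ <;> ext i <;>
    simp [yVec, Y, zRepr, yRepr, xRepr, Finsupp.single_apply]

theorem repr_xVec (x : Fin d → ℝ) :
    e.zRepr (e.xVec x) = 0 ∧ e.yRepr (e.xVec x) = 0 ∧ e.xRepr (e.xVec x) = x := by
  refine ⟨?_, ?_, ?_⟩ <;> ext i <;>
    simp [xVec, X, zRepr, yRepr, xRepr, Finsupp.single_apply]

theorem zVec_zRepr {v : 𝔫} (hv : v ∈ LieAlgebra.center ℝ 𝔫) : e.zVec (e.zRepr v) = v := by
  have h : v ∈ Submodule.span ℝ (Set.range fun k => e.basis (Sum.inl k)) := by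
    rw [e.span_Z]; exact hv
  obtain ⟨c, rfl⟩ := (Submodule.mem_span_range_iff_exists_fun ℝ).1 h
  change e.zVec (e.zRepr (e.zVec c)) = e.zVec c
  rw [(e.repr_zVec c).1]

theorem zVec_mem_center (z : Fin m → ℝ) : e.zVec z ∈ LieAlgebra.center ℝ 𝔫 := by
  have h : e.zVec z ∈ (LieAlgebra.center ℝ 𝔫).toSubmodule := by
    rw [← e.span_Z]
    exact (Submodule.mem_span_range_iff_exists_fun ℝ).2 ⟨z, rfl⟩
  exact h

theorem lie_zVec (v : 𝔫) (z : Fin m → ℝ) : ⁅v, e.zVec z⁆ = 0 :=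
  (LieModule.mem_maxTrivSubmodule ℝ 𝔫 𝔫 _).1 (e.zVec_mem_center z) v

theorem zVec_lie (v : 𝔫) (z : Fin m → ℝ) : ⁅e.zVec z, v⁆ = 0 := by
  rw [← lie_skew, lie_zVec, neg_zero]

theorem lie_yVec (y y' : Fin d → ℝ) : ⁅e.yVec y, e.yVec y'⁆ = 0 := by
  simp [yVec, Y, sum_lie, lie_sum, e.lie_Y]

theorem lie_xVec (y y' : Fin d → ℝ) : ⁅e.xVec y, e.xVec y'⁆ = 0 := by
  simp [xVec, X, sum_lie, lie_sum, e.lie_X]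

variable [TwoStepLie 𝔫]

theorem lie_mem_center (v w : 𝔫) : ⁅v, w⁆ ∈ LieAlgebra.center ℝ 𝔫 :=
  (LieModule.mem_maxTrivSubmodule ℝ 𝔫 𝔫 _).2 fun x => NilGroup.lie_lie_right x v w

theorem log_ofCoords (p : Coords m d) :
    (e.ofCoords p).log = e.zVec p.1 + e.yVec p.2.1 + e.xVec p.2.2
      + (1 / 2 : ℝ) • ⁅e.yVec p.2.1, e.xVec p.2.2⁆ := by
  simp [ofCoords, NilGroup.log_mul, zVec_lie]

theorem toCoords_ofCoords (p : Coords m d) : e.toCoords (e.ofCoords p) = p := by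
  obtain ⟨z, y, x⟩ := p
  have hc := e.zVec_zRepr (Submodule.smul_mem (LieAlgebra.center ℝ 𝔫).toSubmodule (1 / 2 : ℝ)
    (lie_mem_center (e.yVec y) (e.xVec x)))
  have hl := e.log_ofCoords (z, y, x)
  simp only at hl
  have hy : e.yRepr (e.ofCoords (z, y, x)).log = y := by
    rw [hl, ← hc]
    simp [yRepr_add, (e.repr_zVec _).2.1, (e.repr_yVec _).2.1, (e.repr_xVec _).2.1]
  have hx : e.xRepr (e.ofCoords (z, y, x)).log = x := by
    rw [hl, ← hc]
    simp [xRepr_add, (e.repr_zVec _).2.2, (e.repr_yVec _).2.2, (e.repr_xVec _).2.2]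
  simp only [toCoords, hy, hx]
  rw [hl, add_sub_cancel_right]
  simp [zRepr_add, (e.repr_zVec _).1, (e.repr_yVec _).1, (e.repr_xVec _).1]

theorem ofCoords_toCoords (n : NilGroup 𝔫) : e.ofCoords (e.toCoords n) = n := by
  ext
  rw [log_ofCoords]
  have hc := e.zVec_zRepr (Submodule.smul_mem (LieAlgebra.center ℝ 𝔫).toSubmodule (-(1 / 2) : ℝ)
    (lie_mem_center (e.yVec (e.yRepr n.log)) (e.xVec (e.xRepr n.log))))
  have h2 := e.decomp n.log
  simp only [toCoords, sub_eq_add_neg, ← neg_smul, zRepr_add, zVec_add, hc]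
  conv_rhs => rw [← h2]
  module

theorem continuous_ofCoords : Continuous e.ofCoords := by
  letI : TopologicalSpace 𝔫 := moduleTopology ℝ 𝔫
  haveI : IsModuleTopology ℝ 𝔫 := ⟨rfl⟩
  haveI : ContinuousAdd 𝔫 := IsModuleTopology.toContinuousAdd ℝ 𝔫
  haveI : ContinuousSMul ℝ 𝔫 := inferInstance
  refine continuous_induced_rng.2 ?_
  have : (NilGroup.log ∘ e.ofCoords) = fun p : Coords m d =>
      e.zVec p.1 + e.yVec p.2.1 + e.xVec p.2.2
        + (1 / 2 : ℝ) • ⁅e.yVec p.2.1, e.xVec p.2.2⁆ := by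
    funext p; exact e.log_ofCoords p
  rw [this]
  simp only [zVec, yVec, xVec, sum_lie, lie_sum, smul_lie, lie_smul]
  fun_prop

theorem continuous_toCoords : Continuous e.toCoords := by
  letI : TopologicalSpace 𝔫 := moduleTopology ℝ 𝔫
  haveI : IsModuleTopology ℝ 𝔫 := ⟨rfl⟩
  haveI : ContinuousAdd 𝔫 := IsModuleTopology.toContinuousAdd ℝ 𝔫
  haveI : IsTopologicalAddGroup 𝔫 := IsModuleTopology.topologicalAddGroup ℝ 𝔫
  haveI : ContinuousSMul ℝ 𝔫 := inferInstance
  have hlog : Continuous (NilGroup.log : NilGroup 𝔫 → 𝔫) := continuous_induced_dom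
  have hrep : ∀ i, Continuous fun v : 𝔫 => e.basis.repr v i := fun i =>
    IsModuleTopology.continuous_of_linearMap (e.basis.coord i)
  have hy : Continuous fun n : NilGroup 𝔫 => e.yRepr n.log :=
    continuous_pi fun i => (hrep _).comp hlog
  have hx : Continuous fun n : NilGroup 𝔫 => e.xRepr n.log :=
    continuous_pi fun i => (hrep _).comp hlog
  refine Continuous.prodMk (continuous_pi fun i => (hrep _).comp ?_) (hy.prodMk hx)
  refine hlog.sub ?_
  simp only [yVec, xVec, sum_lie, lie_sum, smul_lie, lie_smul]
  fun_prop

/-- The global chart `(z, y, x) ↦ exp (∑ z_k Z_k) exp (∑ y_j Y_j) exp (∑ x_j X_j)` of `N`. -/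
def chart : Coords m d ≃ₜ NilGroup 𝔫 where
  toFun := e.ofCoords
  invFun := e.toCoords
  left_inv := e.toCoords_ofCoords
  right_inv := e.ofCoords_toCoords
  continuous_toFun := e.continuous_ofCoords
  continuous_invFun := e.continuous_toCoords

/-- The Haar measure of `N`: Lebesgue measure `dz dy dx` in the coordinates `(z, y, x)`. -/
def haar : Measure (NilGroup 𝔫) := (volume : Measure (Coords m d)).map e.ofCoords

theorem measurePreserving_ofCoords : MeasurePreserving e.ofCoords volume e.haar :=
  ⟨e.continuous_ofCoords.measurable, rfl⟩

theorem measurePreserving_toCoords : MeasurePreserving e.toCoords e.haar volume :=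
  (MeasurePreserving.symm e.chart.toMeasurableEquiv e.measurePreserving_ofCoords :)

/-- The group law in coordinates. -/
theorem ofCoords_mul (g p : Coords m d) : e.ofCoords g * e.ofCoords p =
    e.ofCoords (p.1 + (g.1 + e.zRepr ⁅e.xVec g.2.2, e.yVec p.2.1⁆),
      p.2.1 + g.2.1, p.2.2 + g.2.2) := by
  ext
  have hc := e.zVec_zRepr (lie_mem_center (e.xVec g.2.2) (e.yVec p.2.1))
  rw [NilGroup.log_mul]
  simp only [log_ofCoords, zVec_add, yVec_add, xVec_add, hc, lie_add, add_lie, lie_smul, smul_lie,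
    TwoStepLie.lie_lie_eq_zero, NilGroup.lie_lie_right, lie_zVec, zVec_lie, lie_yVec, lie_xVec]
  rw [← lie_skew (e.xVec g.2.2) (e.yVec p.2.1)]
  module

theorem measurePreserving_mul_left (g : NilGroup 𝔫) :
    MeasurePreserving (fun n => g * n) e.haar e.haar := by
  set c := e.toCoords g with hc
  have hshift : MeasurePreserving (fun p : Coords m d =>
      ((p.1 + (c.1 + e.zRepr ⁅e.xVec c.2.2, e.yVec p.2.1⁆), p.2.1 + c.2.1, p.2.2 + c.2.2) :
        Coords m d)) volume volume := by
    have hb : MeasurePreserving (fun r : (Fin d → ℝ) × (Fin d → ℝ) => (r.1 + c.2.1, r.2 + c.2.2))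
        volume volume :=
      (measurePreserving_add_right volume c.2.1).prod (measurePreserving_add_right volume c.2.2)
    have hm : Measurable fun y : Fin d → ℝ => e.zRepr ⁅e.xVec c.2.2, e.yVec y⁆ := by
      refine measurable_pi_lambda _ fun k => ?_
      simp only [zRepr, yVec, lie_sum, lie_smul, map_sum, map_smul, Finsupp.coe_finsetSum,
        Finset.sum_apply, Finsupp.smul_apply, smul_eq_mul]
      fun_prop
    have h := MeasurePreserving.skew_product (μa := (volume : Measure ((Fin d → ℝ) × (Fin d → ℝ))))
      (μb := volume) (μc := (volume : Measure (Fin m → ℝ))) (μd := volume) hb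
      (g := fun r z => z + (c.1 + e.zRepr ⁅e.xVec c.2.2, e.yVec r.1⁆)) (by
        simp only [Function.uncurry_def]
        have := hm.comp (measurable_fst.comp measurable_fst :
          Measurable fun p : ((Fin d → ℝ) × (Fin d → ℝ)) × (Fin m → ℝ) => p.1.1)
        fun_prop)
      (Filter.Eventually.of_forall fun r => (measurePreserving_add_right volume _).map_eq)
    exact (Measure.measurePreserving_swap.comp h).comp Measure.measurePreserving_swap
  have h := (e.measurePreserving_ofCoords.comp hshift).comp e.measurePreserving_toCoords
  convert h using 1
  funext n
  have := e.ofCoords_mul c (e.toCoords n)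
  rw [e.ofCoords_toCoords, hc, e.ofCoords_toCoords] at this
  exact this

/-! ### The left regular representation and the quasi-lattices -/

/-- `L²(N)` -/
abbrev L2N : Type _ := Lp ℂ 2 e.haar

/-- The left regular representation `(L(g) f)(n) = f(g⁻¹ n)` on `L²(N)`. -/
def leftRegular (g : NilGroup 𝔫) : e.L2N →ₗᵢ[ℂ] e.L2N :=
  Lp.compMeasurePreservingₗᵢ ℂ (fun n => g⁻¹ * n) (e.measurePreserving_mul_left g⁻¹)

/-- The quasi-lattice `Γ_{a,q,b}` of all
`exp (∑ (m_j / a_j) Z_j) exp (∑ (k_j / q_j) Y_j) exp (∑ (n_j / b_j) X_j)`, `m_j, k_j, n_j ∈ ℤ`. -/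
def quasiLattice (a : Fin m → ℝ) (q b : Fin d → ℝ) : Set (NilGroup 𝔫) :=
  {g | ∃ (i : Fin m → ℤ) (k n : Fin d → ℤ),
    g = NilGroup.exp (e.zVec fun j => i j / a j) * NilGroup.exp (e.yVec fun j => k j / q j) *
      NilGroup.exp (e.xVec fun j => n j / b j)}

/-! ### Linear functionals on the center and the Plancherel measure -/

/-- The linear functional on `𝔫` with `Z_k ↦ ℓ_k`, `Y_j ↦ 0`, `X_j ↦ 0`; this identifies `ℝ^m` with
the dual of the center. -/
def functional (ℓ : Fin m → ℝ) : Module.Dual ℝ 𝔫 := ∑ k, ℓ k • e.basis.coord (Sum.inl k)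

/-- `V(ℓ) = (ℓ[E_i, E_j])_{i,j}`, where `E` runs through `Y_1, …, Y_d, X_1, …, X_d`. -/
def matrixV (ℓ : Fin m → ℝ) : Matrix (Fin d ⊕ Fin d) (Fin d ⊕ Fin d) ℝ :=
  Matrix.of fun i j => e.functional ℓ ⁅e.basis (Sum.inr i), e.basis (Sum.inr j)⁆

/-- `B(ℓ) = (-ℓ[X_i, Y_j])_{i,j}` -/
def matrixB (ℓ : Fin m → ℝ) : Matrix (Fin d) (Fin d) ℝ :=
  Matrix.of fun i j => -e.functional ℓ ⁅e.X i, e.Y j⁆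

/-- The cross-section `Σ` of the generic coadjoint orbits, inside the dual `ℝ^m` of the center. -/
def crossSection : Set (Fin m → ℝ) := {ℓ | (e.matrixV ℓ).det ≠ 0}

/-- The Plancherel measure `dμ(ℓ) = |det B(ℓ)| dℓ` on `Σ`. -/
def plancherelMeasure : Measure (Fin m → ℝ) :=
  (volume.restrict e.crossSection).withDensity fun ℓ => ENNReal.ofReal |(e.matrixB ℓ).det|

/-! ### The irreducible representations `π_ℓ` on `L²(ℝ^d)` -/

/-- `L²(ℝ^d)` -/
abbrev L2R (d : ℕ) : Type := Lp ℂ 2 (volume : Measure (Fin d → ℝ))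

/-- `L²(ℝ^d × ℝ^d)`-kernels live on this space. -/
abbrev Plane (d : ℕ) : Type := (Fin d → ℝ) × (Fin d → ℝ)

theorem norm_phase (r : ℝ) : ‖Complex.exp (2 * Real.pi * Complex.I * r)‖ = 1 := by
  rw [show 2 * (Real.pi : ℂ) * Complex.I * r = ((2 * Real.pi * r : ℝ) : ℂ) * Complex.I by
    push_cast; ring]
  exact Complex.norm_exp_ofReal_mul_I _

theorem memLp_phase_mul {θ : (Fin d → ℝ) → ℝ} (hθ : Measurable θ) (F : L2R d) :
    MemLp (fun t => Complex.exp (2 * Real.pi * Complex.I * θ t) * F t) 2 volume := by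
  refine (Lp.memLp F).of_le (AEStronglyMeasurable.mul ?_ (Lp.aestronglyMeasurable F))
    (Filter.Eventually.of_forall fun t => ?_)
  · have : Measurable fun t => Complex.exp (2 * Real.pi * Complex.I * θ t) := by fun_prop
    exact this.aestronglyMeasurable
  · rw [norm_mul, norm_phase, one_mul]

/-- Multiplication by `t ↦ exp (2 π i θ(t))` on `L²(ℝ^d)`. -/
def modulation (θ : (Fin d → ℝ) → ℝ) (hθ : Measurable θ) : L2R d →ₗᵢ[ℂ] L2R d where
  toFun F := (memLp_phase_mul hθ F).toLp _
  map_add' F G := by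
    rw [← MemLp.toLp_add]
    refine MemLp.toLp_congr _ _ ?_
    filter_upwards [Lp.coeFn_add F G] with t ht
    rw [ht, Pi.add_apply, Pi.add_apply, mul_add]
  map_smul' c F := by
    rw [RingHom.id_apply, ← MemLp.toLp_const_smul]
    refine MemLp.toLp_congr _ _ ?_
    filter_upwards [Lp.coeFn_smul c F] with t ht
    rw [ht, Pi.smul_apply, Pi.smul_apply, smul_eq_mul, smul_eq_mul]
    ring
  norm_map' F := by
    change ‖(memLp_phase_mul hθ F).toLp _‖ = ‖F‖
    refine le_antisymm (Lp.norm_le_norm_of_ae_le ?_) (Lp.norm_le_norm_of_ae_le ?_) <;>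
    · filter_upwards [MemLp.coeFn_toLp (memLp_phase_mul hθ F)] with t ht
      rw [ht, norm_mul, norm_phase, one_mul]

/-- Translation `F ↦ F(· - x)` on `L²(ℝ^d)`. -/
def translation (x : Fin d → ℝ) : L2R d →ₗᵢ[ℂ] L2R d :=
  Lp.compMeasurePreservingₗᵢ ℂ (fun t => t - x) (measurePreserving_sub_right volume x)

/-- The phase `⟨ℓ, z⟩ + ⟨t, B(ℓ) y⟩` by which `π_ℓ` modulates at `t`. -/
def phase (ℓ : Fin m → ℝ) (p : Coords m d) (t : Fin d → ℝ) : ℝ :=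
  ℓ ⬝ᵥ p.1 + t ⬝ᵥ (e.matrixB ℓ *ᵥ p.2.1)

theorem measurable_phase (ℓ : Fin m → ℝ) (p : Coords m d) : Measurable (e.phase ℓ p) := by
  unfold phase dotProduct
  fun_prop

/-- The representation of `N` induced from the character `exp (2 π i ℓ)` of the subgroup
`P = exp (span {Z_k, Y_j})`, realized on `L²(ℝ^d)`: if `n` has the coordinates `(z, y, x)`, then
`(π_ℓ(n) F)(t) = exp (2 π i (⟨ℓ, z⟩ + ⟨t, B(ℓ) y⟩)) F(t - x)`. -/
def rep (ℓ : Fin m → ℝ) (n : NilGroup 𝔫) : L2R d →ₗᵢ[ℂ] L2R d :=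
  (modulation (e.phase ℓ (e.toCoords n)) (e.measurable_phase ℓ (e.toCoords n))).comp
    (translation (e.toCoords n).2.2)

theorem coeFn_rep (ℓ : Fin m → ℝ) (n : NilGroup 𝔫) (F : L2R d) :
    e.rep ℓ n F =ᵐ[volume] fun t =>
      Complex.exp (2 * Real.pi * Complex.I * e.phase ℓ (e.toCoords n) t) *
        F (t - (e.toCoords n).2.2) := by
  have h1 := MemLp.coeFn_toLp (memLp_phase_mul (e.measurable_phase ℓ (e.toCoords n))
    (translation (e.toCoords n).2.2 F))
  have h2 : translation (e.toCoords n).2.2 F =ᵐ[volume] fun t => F (t - (e.toCoords n).2.2) :=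
    Lp.coeFn_compMeasurePreserving F (measurePreserving_sub_right volume _)
  filter_upwards [h1, h2] with t ht1 ht2
  rw [← ht2]
  exact ht1

/-! ### The Plancherel transform -/

/-- The matrix coefficient `⟨π_ℓ(n) h, g⟩` (the inner product of Mathlib is conjugate linear in its
first argument). -/
def coeff (ℓ : Fin m → ℝ) (g h : L2R d) (n : NilGroup 𝔫) : ℂ := inner ℂ g (e.rep ℓ n h)

theorem aestronglyMeasurable_coeff (ℓ : Fin m → ℝ) (g h : L2R d) :
    AEStronglyMeasurable (e.coeff ℓ g h) e.haar := by
  have h0 : e.coeff ℓ g h = (fun p : Coords m d => ∫ t, (starRingEnd ℂ) (g t) *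
      (Complex.exp (2 * Real.pi * Complex.I * e.phase ℓ p t) * h (t - p.2.2))) ∘ e.toCoords := by
    funext n
    rw [coeff, L2.inner_def]
    refine integral_congr_ae ?_
    filter_upwards [e.coeFn_rep ℓ n h] with t ht
    simp only [RCLike.inner_apply, ht]
    ring
  have h1 : StronglyMeasurable fun p : Coords m d => ∫ t, (starRingEnd ℂ) (g t) *
      (Complex.exp (2 * Real.pi * Complex.I * e.phase ℓ p t) * h (t - p.2.2)) := by
    refine StronglyMeasurable.integral_prod_right (f := fun (p : Coords m d) (t : Fin d → ℝ) =>
      (starRingEnd ℂ) (g t) *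
      (Complex.exp (2 * Real.pi * Complex.I * e.phase ℓ p t) * h (t - p.2.2))) ?_
    refine Measurable.stronglyMeasurable ?_
    have hg : Measurable g := (Lp.stronglyMeasurable g).measurable
    have hh : Measurable h := (Lp.stronglyMeasurable h).measurable
    have hp : Measurable fun x : Coords m d × (Fin d → ℝ) => e.phase ℓ x.1 x.2 := by
      unfold phase dotProduct mulVec dotProduct
      fun_prop
    simp only [Function.uncurry_def]
    have hh' := hh.comp (by fun_prop :
      Measurable fun x : Coords m d × (Fin d → ℝ) => x.2 - x.1.2.2)
    have hg' := hg.comp (measurable_snd : Measurable fun x : Coords m d × (Fin d → ℝ) => x.2)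
    refine Measurable.mul ?_ (Measurable.mul (by fun_prop) hh')
    exact Complex.continuous_conj.measurable.comp hg'
  rw [h0]
  exact (h1.comp_measurable e.continuous_toCoords.measurable).aestronglyMeasurable

theorem integrable_mul_coeff (ℓ : Fin m → ℝ) (g h : L2R d) {f : NilGroup 𝔫 → ℂ}
    (hf : Integrable f e.haar) : Integrable (fun n => f n * e.coeff ℓ g h n) e.haar :=
  hf.mul_bdd (c := ‖g‖ * ‖h‖) (e.aestronglyMeasurable_coeff ℓ g h)
    (Filter.Eventually.of_forall fun n =>
      (norm_inner_le_norm g (e.rep ℓ n h)).trans (by rw [LinearIsometry.norm_map]))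

/-- The sesquilinear form `⟨T h, g⟩` of the Hilbert-Schmidt operator
`(T h)(t) = ∫ k(t, s) h(s) ds` on `L²(ℝ^d)`. -/
def kernelForm (k : Plane d → ℂ) (g h : L2R d) : ℂ :=
  ∫ p : Plane d, k p * ((starRingEnd ℂ) (g p.1) * h p.2)

theorem integrable_kernelForm {k : Plane d → ℂ} (hk : MemLp k 2 volume) (g h : L2R d) :
    Integrable (fun p : Plane d => k p * ((starRingEnd ℂ) (g p.1) * h p.2)) volume := by
  refine MemLp.integrable_mul (p := 2) (q := 2) hk ?_
  have hg : MemLp (fun p : Plane d => (starRingEnd ℂ) (g p.1) * h p.2) 2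
      ((volume : Measure (Fin d → ℝ)).prod volume) := by
    have hm : AEStronglyMeasurable (fun p : Plane d => (starRingEnd ℂ) (g p.1) * h p.2)
        ((volume : Measure (Fin d → ℝ)).prod volume) :=
      (Complex.continuous_conj.comp_aestronglyMeasurable
        (Lp.aestronglyMeasurable g).comp_fst).mul (Lp.aestronglyMeasurable h).comp_snd
    rw [memLp_two_iff_integrable_sq_norm hm]
    have h1 := (memLp_two_iff_integrable_sq_norm (Lp.aestronglyMeasurable g)).1 (Lp.memLp g)
    have h2 := (memLp_two_iff_integrable_sq_norm (Lp.aestronglyMeasurable h)).1 (Lp.memLp h)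
    refine (h1.mul_prod h2).congr (Filter.Eventually.of_forall fun p => ?_)
    simp [mul_pow]
  exact hg

/-- `k` is the integral kernel of the Hilbert-Schmidt operator
`F(f)(ℓ) = ∫_N f(n) π_ℓ(n) dn` on `L²(ℝ^d)`. The operator-valued integral is a weak integral. -/
def IsFourierKernel (f : NilGroup 𝔫 → ℂ) (ℓ : Fin m → ℝ) (k : Plane d → ℂ) : Prop :=
  MemLp k 2 volume ∧
    ∀ g h : L2R d, kernelForm k g h = ∫ n, f n * e.coeff ℓ g h n ∂e.haar

/-- The direct integral `∫^⊕_Σ L²(ℝ^d) ⊗ L²(ℝ^d) dμ(ℓ)`, realized as the space of all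
square-integrable families `K(ℓ, ·, ·)` of integral kernels of Hilbert-Schmidt operators, with
respect to `dμ(ℓ) dt ds`. -/
abbrev L2Sigma : Type := Lp ℂ 2 (e.plancherelMeasure.prod (volume : Measure (Plane d)))

/-- The graph of the Fourier transform on `L¹(N) ∩ L²(N)`. -/
def fourierGraph : Submodule ℂ (e.L2N × e.L2Sigma) where
  carrier := {fK | Integrable fK.1 e.haar ∧
    ∀ᵐ ℓ ∂e.plancherelMeasure, e.IsFourierKernel fK.1 ℓ fun p => fK.2 (ℓ, p)}
  zero_mem' := by
    refine ⟨(integrable_zero _ _ _).congr (Lp.coeFn_zero ℂ 2 e.haar).symm, ?_⟩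
    filter_upwards [Measure.ae_ae_of_ae_prod
      (Lp.coeFn_zero ℂ 2 (e.plancherelMeasure.prod (volume : Measure (Plane d))))] with ℓ hℓ
    refine ⟨(MemLp.zero (ε := ℂ)).ae_eq (Filter.EventuallyEq.symm hℓ), fun g h => ?_⟩
    have h1 : kernelForm (fun p => (0 : e.L2Sigma) (ℓ, p)) g h = 0 := by
      refine integral_eq_zero_of_ae ?_
      filter_upwards [hℓ] with p hp
      simp only [hp, Pi.zero_apply, zero_mul]
    have h2 : ∫ n, (0 : e.L2N) n * e.coeff ℓ g h n ∂e.haar = 0 := by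
      refine integral_eq_zero_of_ae ?_
      filter_upwards [Lp.coeFn_zero ℂ 2 e.haar] with n hn
      simp only [hn, Pi.zero_apply, zero_mul]
    exact h1.trans h2.symm
  add_mem' := by
    rintro ⟨f, K⟩ ⟨f', K'⟩ ⟨hf, hK⟩ ⟨hf', hK'⟩
    refine ⟨(hf.add hf').congr (Lp.coeFn_add f f').symm, ?_⟩
    filter_upwards [hK, hK', Measure.ae_ae_of_ae_prod (Lp.coeFn_add K K')] with ℓ h1 h2 h3
    refine ⟨(h1.1.add h2.1).ae_eq (Filter.EventuallyEq.symm h3), fun g h => ?_⟩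
    have e1 : kernelForm (fun p => (K + K') (ℓ, p)) g h =
        kernelForm (fun p => K (ℓ, p)) g h + kernelForm (fun p => K' (ℓ, p)) g h := by
      rw [kernelForm, kernelForm, kernelForm,
        ← integral_add (integrable_kernelForm h1.1 g h) (integrable_kernelForm h2.1 g h)]
      refine integral_congr_ae ?_
      filter_upwards [h3] with p hp
      simp only [hp, Pi.add_apply, add_mul]
    have e2 : ∫ n, (f + f') n * e.coeff ℓ g h n ∂e.haar =
        ∫ n, f n * e.coeff ℓ g h n ∂e.haar + ∫ n, f' n * e.coeff ℓ g h n ∂e.haar := by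
      rw [← integral_add (e.integrable_mul_coeff ℓ g h hf) (e.integrable_mul_coeff ℓ g h hf')]
      refine integral_congr_ae ?_
      filter_upwards [Lp.coeFn_add f f'] with n hn
      simp only [hn, Pi.add_apply, add_mul]
    exact e1.trans ((congrArg₂ (· + ·) (h1.2 g h) (h2.2 g h)).trans e2.symm)
  smul_mem' := by
    rintro c ⟨f, K⟩ ⟨hf, hK⟩
    refine ⟨(hf.smul c).congr (Lp.coeFn_smul c f).symm, ?_⟩
    filter_upwards [hK, Measure.ae_ae_of_ae_prod (Lp.coeFn_smul c K)] with ℓ h1 h3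
    refine ⟨(h1.1.const_smul c).ae_eq (Filter.EventuallyEq.symm h3), fun g h => ?_⟩
    have e1 : kernelForm (fun p => (c • K) (ℓ, p)) g h =
        c * kernelForm (fun p => K (ℓ, p)) g h := by
      rw [kernelForm, kernelForm, ← integral_const_mul]
      refine integral_congr_ae ?_
      filter_upwards [h3] with p hp
      simp only [hp, Pi.smul_apply, smul_eq_mul, mul_assoc]
    have e2 : ∫ n, (c • f) n * e.coeff ℓ g h n ∂e.haar =
        c * ∫ n, f n * e.coeff ℓ g h n ∂e.haar := by
      rw [← integral_const_mul]
      refine integral_congr_ae ?_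
      filter_upwards [Lp.coeFn_smul c f] with n hn
      simp only [hn, Pi.smul_apply, smul_eq_mul, mul_assoc]
    exact e1.trans ((congrArg (c * ·) (h1.2 g h)).trans e2.symm)

/-- The graph of the Plancherel transform `P`, the extension of the Fourier transform from
`L¹(N) ∩ L²(N)` to `L²(N)` by continuity: `K = P f` if and only if some `f_j ∈ L¹(N) ∩ L²(N)`
converge to `f` in `L²(N)` while their Fourier transforms converge to `K`. -/
def plancherelGraph : Submodule ℂ (e.L2N × e.L2Sigma) := e.fourierGraph.topologicalClosure

/-! ### Multiplicity-free band-limited spaces and Parseval frames -/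

/-- The subspace `F = ∫^⊕_I L²(ℝ^d) ⊗ u dμ(ℓ)` of the direct integral. The tensor `v ⊗ u` is the
operator `h ↦ ⟨h, u⟩ v`, whose kernel is `v(t) * conj (u(s))`. -/
def rankOneField (I : Set (Fin m → ℝ)) (u : L2R d) : Submodule ℂ e.L2Sigma where
  carrier := {K | ∀ᵐ ℓ ∂e.plancherelMeasure,
    (ℓ ∈ I → ∃ v : L2R d, ∀ᵐ p : Plane d, K (ℓ, p) = v p.1 * (starRingEnd ℂ) (u p.2)) ∧
    (ℓ ∉ I → ∀ᵐ p : Plane d, K (ℓ, p) = 0)}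
  zero_mem' := by
    filter_upwards [Measure.ae_ae_of_ae_prod
      (Lp.coeFn_zero ℂ 2 (e.plancherelMeasure.prod (volume : Measure (Plane d))))] with ℓ hℓ
    refine ⟨fun _ => ⟨0, ?_⟩, fun _ => hℓ⟩
    have h0 := (Measure.quasiMeasurePreserving_fst (μ := (volume : Measure (Fin d → ℝ)))
      (ν := (volume : Measure (Fin d → ℝ)))).ae (Lp.coeFn_zero ℂ 2 volume)
    filter_upwards [hℓ, h0] with p hp hp0
    rw [hp, hp0]
    simp
  add_mem' := by
    intro K K' hK hK'
    filter_upwards [hK, hK', Measure.ae_ae_of_ae_prod (Lp.coeFn_add K K')] with ℓ h1 h2 h3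
    refine ⟨fun hI => ?_, fun hI => ?_⟩
    · obtain ⟨v, hv⟩ := h1.1 hI
      obtain ⟨w, hw⟩ := h2.1 hI
      refine ⟨v + w, ?_⟩
      have h0 := (Measure.quasiMeasurePreserving_fst (μ := (volume : Measure (Fin d → ℝ)))
        (ν := (volume : Measure (Fin d → ℝ)))).ae (Lp.coeFn_add v w)
      filter_upwards [hv, hw, h3, h0] with p hp1 hp2 hp3 hp0
      rw [hp3, hp0, Pi.add_apply, Pi.add_apply, hp1, hp2, add_mul]
    · filter_upwards [h1.2 hI, h2.2 hI, h3] with p hp1 hp2 hp3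
      rw [hp3, Pi.add_apply, hp1, hp2, add_zero]
  smul_mem' := by
    intro c K hK
    filter_upwards [hK, Measure.ae_ae_of_ae_prod (Lp.coeFn_smul c K)] with ℓ h1 h3
    refine ⟨fun hI => ?_, fun hI => ?_⟩
    · obtain ⟨v, hv⟩ := h1.1 hI
      refine ⟨c • v, ?_⟩
      have h0 := (Measure.quasiMeasurePreserving_fst (μ := (volume : Measure (Fin d → ℝ)))
        (ν := (volume : Measure (Fin d → ℝ)))).ae (Lp.coeFn_smul c v)
      filter_upwards [hv, h3, h0] with p hp1 hp3 hp0
      rw [hp3, hp0, Pi.smul_apply, Pi.smul_apply, hp1, smul_mul_assoc]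
    · filter_upwards [h1.2 hI, h3] with p hp1 hp3
      rw [hp3, Pi.smul_apply, hp1, smul_zero]

/-- The multiplicity-free band-limited space `H = P⁻¹(∫^⊕_I L²(ℝ^d) ⊗ u dμ(ℓ))` in `L²(N)`. -/
def bandLimitedSpace (I : Set (Fin m → ℝ)) (u : L2R d) : Submodule ℂ e.L2N :=
  (e.plancherelGraph ⊓ (e.rankOneField I u).comap (LinearMap.snd ℂ e.L2N e.L2Sigma)).map
    (LinearMap.fst ℂ e.L2N e.L2Sigma)

end AdaptedBasis

/-- The family `f` of vectors of a Hilbert space is a Parseval frame in its subspace `H`. -/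
def IsParsevalFrame {E ι : Type*} [NormedAddCommGroup E] [InnerProductSpace ℂ E]
    (H : Submodule ℂ E) (f : ι → E) : Prop :=
  (∀ i, f i ∈ H) ∧ ∀ x ∈ H, HasSum (fun i => ‖inner ℂ (f i) x‖ ^ 2) (‖x‖ ^ 2)

end

/-! The Parseval identity is averaged over a fundamental domain. Let ψ in 𝓗 be the function whose
Plancherel transform is the field of rank-one projections 1_I(ℓ) u ⊗ u, so that ‖ψ‖² = μ(I). The
space 𝓗 is invariant under left translation, so the frame identity applies to L(p)⁻¹ψ for every p in
N and reads ∑_γ |⟨L(pγ)η, ψ⟩|² = μ(I). Let D be the box with sides 1/a_k, 1/q_j, 1/b_j. Its right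
translates Dγ are disjoint, even though Γ need not be a group (`cellIndex_rightShift`), and right
translation preserves the measure. Integrating over p in D gives μ(I) vol(D) ≤ ∫_N |⟨L(g)η, ψ⟩|² dg.
The right side is at most ‖η‖² ≤ 1 (`lintegral_fieldCoeff_le`, `norm_le_one_of_isParsevalFrame`),
and vol(D) is the inverse of the product in the bound.

The Plancherel transform is given only as the closure of a graph, so its isometry, surjectivity and
equivariance have to be proved. They rest on one formula: the operator ∫ f(n) π_ℓ(n) dn has at (t,
s) the kernel obtained by Fourier transforming f in (z, y) at the frequency (ℓ, B(ℓ)ᵀt), with x = t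
- s (`mem_fourierGraph_iff`). The change of variables (ℓ, t) ↦ (ℓ, B(ℓ)ᵀt) has Jacobian |det B(ℓ)|,
the density of μ, so everything reduces to Euclidean Plancherel in (z, y).

The same reduction bounds the matrix coefficients. For fixed x, the conjugate of ⟨L(z, y, x)η, ψ⟩ is
a Euclidean Fourier integral in (ℓ, t); Parseval in (z, y), integration over x and Cauchy-Schwarz
against the unit vector u then give the bound by ‖η‖². -/

noncomputable section

/-! ### The Euclidean Fourier transform on L¹ ∩ L² -/

section FourierL2

open FourierTransform SchwartzMap
open scoped ContDiff RealInnerProductSpace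

variable {E : Type*} [NormedAddCommGroup E] [InnerProductSpace ℝ E] [FiniteDimensional ℝ E]
  [MeasurableSpace E] [BorelSpace E]

/-- On `L¹ ∩ L²` the Fourier transform of `L²` is given by the Fourier integral. -/
theorem fourier_toLp_ae_eq {f : E → ℂ} (h1 : Integrable f) (h2 : MemLp f 2) :
    ((𝓕 (h2.toLp f) : Lp ℂ 2 (volume : Measure E)) : E → ℂ) =ᵐ[volume] 𝓕 f := by
  have hcont : Continuous (𝓕 f) := VectorFourier.fourierIntegral_continuous
    Real.continuous_fourierChar continuous_inner h1
  refine ae_eq_of_integral_contDiff_smul_eq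
    ((Lp.memLp _).locallyIntegrable (by norm_num)) hcont.locallyIntegrable fun g hg hgs => ?_
  have hg₁ : HasCompactSupport (Complex.ofRealCLM ∘ g) := hgs.comp_left rfl
  have hg₂ : ContDiff ℝ ∞ (Complex.ofRealCLM ∘ g) := by fun_prop
  set φ : 𝓢(E, ℂ) := hg₁.toSchwartzMap hg₂
  have hφa : ∀ x, φ x = (g x : ℂ) := fun x => rfl
  -- The distributional Fourier transform is defined by duality, which moves the transform onto φ;
  -- the self-adjointness of the Fourier integral (`e3`) moves it back onto `f`.
  have key := congrArg (fun T => T φ) (Lp.fourier_toTemperedDistribution_eq (h2.toLp f))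
  simp only [TemperedDistribution.fourier_apply, Lp.toTemperedDistribution_apply] at key
  have e1 : ∫ x, g x • (𝓕 (h2.toLp f) : Lp ℂ 2 (volume : Measure E)) x =
      ∫ x, φ x • (𝓕 (h2.toLp f) : Lp ℂ 2 (volume : Measure E)) x := by
    simp [hφa]
  have e2 : ∫ x, g x • 𝓕 f x = ∫ x, φ x • 𝓕 f x := by simp [hφa]
  rw [e1, e2, ← key]
  have e3 := VectorFourier.integral_fourierIntegral_smul_eq_flip (μ := (volume : Measure E))
    (ν := (volume : Measure E)) (L := innerₗ E) Real.continuous_fourierChar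
    continuous_inner φ.integrable h1
  rw [flip_innerₗ] at e3
  refine Eq.trans (integral_congr_ae ?_) e3
  filter_upwards [h2.coeFn_toLp] with x hx
  rw [hx]
  rfl

theorem lintegral_enorm_sq_eq {α : Type*} [MeasurableSpace α] {μ : Measure α} (f : α → ℂ) :
    ∫⁻ x, ‖f x‖ₑ ^ 2 ∂μ = eLpNorm f 2 μ ^ 2 := by
  rw [eLpNorm_eq_lintegral_rpow_enorm_toReal (by norm_num) (by norm_num)]
  rw [← ENNReal.rpow_natCast, ← ENNReal.rpow_mul]
  simp

/-- The extended nonnegative form lets Parseval be applied to almost every section inside a Tonelli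
integral. -/
theorem lintegral_fourier_enorm_sq {f : E → ℂ} (h1 : Integrable f) (h2 : MemLp f 2) :
    ∫⁻ x, ‖𝓕 f x‖ₑ ^ 2 = ∫⁻ x, ‖f x‖ₑ ^ 2 := by
  rw [lintegral_enorm_sq_eq, lintegral_enorm_sq_eq, ← eLpNorm_congr_ae (fourier_toLp_ae_eq h1 h2),
    ← Lp.enorm_def, ← eLpNorm_congr_ae h2.coeFn_toLp, ← Lp.enorm_def]
  congr 1
  rw [← ofReal_norm, ← ofReal_norm, Lp.norm_fourier_eq]

end FourierL2

/-! ### Fourier integrals on ℝ^m × ℝ^d -/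

section FourierProduct

open FourierTransform SchwartzMap
open scoped ContDiff RealInnerProductSpace

variable {m d : ℕ}

/-- The character `p ↦ exp (2 π i ⟨w, p⟩)` of `ℝ^m × ℝ^d`. -/
def pairChar (w p : (Fin m → ℝ) × (Fin d → ℝ)) : ℂ :=
  Complex.exp (2 * Real.pi * Complex.I * (w.1 ⬝ᵥ p.1 + w.2 ⬝ᵥ p.2 : ℝ))

theorem norm_pairChar (w p : (Fin m → ℝ) × (Fin d → ℝ)) : ‖pairChar w p‖ = 1 :=
  AdaptedBasis.norm_phase _

theorem continuous_pairChar : Continuous fun x : ((Fin m → ℝ) × (Fin d → ℝ)) ×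
    ((Fin m → ℝ) × (Fin d → ℝ)) => pairChar x.1 x.2 := by
  unfold pairChar dotProduct
  fun_prop

theorem measurable_pairChar_comp {α : Type*} [MeasurableSpace α]
    {f g : α → (Fin m → ℝ) × (Fin d → ℝ)} (hf : Measurable f) (hg : Measurable g) :
    Measurable fun x => pairChar (f x) (g x) := by
  unfold pairChar dotProduct
  fun_prop

/-- The Fourier integral on `ℝ^m × ℝ^d` with the positive exponent. -/
def charIntegral (g : (Fin m → ℝ) × (Fin d → ℝ) → ℂ) (w : (Fin m → ℝ) × (Fin d → ℝ)) : ℂ :=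
  ∫ p, pairChar w p * g p

/-- The product of two Euclidean spaces with its Euclidean norm, as a normed space with inner
product. -/
abbrev EuclProd (m d : ℕ) : Type := WithLp 2 (EuclideanSpace ℝ (Fin m) × EuclideanSpace ℝ (Fin d))

/-- The coordinate spaces carry sup norms, while the Fourier theory needs an inner product;
everything is transported along this volume-preserving map. -/
def euclProdEquiv (m d : ℕ) : EuclProd m d ≃L[ℝ] (Fin m → ℝ) × (Fin d → ℝ) :=
  (WithLp.prodContinuousLinearEquiv 2 ℝ _ _).trans
    ((EuclideanSpace.equiv (Fin m) ℝ).prodCongr (EuclideanSpace.equiv (Fin d) ℝ))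

theorem measurePreserving_euclProdEquiv : MeasurePreserving (euclProdEquiv m d) := by
  have h1 := WithLp.volume_preserving_ofLp (EuclideanSpace ℝ (Fin m)) (EuclideanSpace ℝ (Fin d))
  have h2 : MeasurePreserving (Prod.map (WithLp.ofLp : EuclideanSpace ℝ (Fin m) → _)
      (WithLp.ofLp : EuclideanSpace ℝ (Fin d) → _)) :=
    (PiLp.volume_preserving_ofLp (Fin m)).prod (PiLp.volume_preserving_ofLp (Fin d))
  exact h2.comp h1

theorem measurableEmbedding_euclProdEquiv : MeasurableEmbedding (euclProdEquiv m d) :=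
  (euclProdEquiv m d).toHomeomorph.measurableEmbedding

theorem measurePreserving_euclProdEquiv_symm : MeasurePreserving (euclProdEquiv m d).symm :=
  (measurePreserving_euclProdEquiv (m := m) (d := d)).symm
    (euclProdEquiv m d).toHomeomorph.toMeasurableEquiv

theorem inner_eq_dotProduct (x y : EuclProd m d) : ⟪x, y⟫ =
    (euclProdEquiv m d x).1 ⬝ᵥ (euclProdEquiv m d y).1 +
      (euclProdEquiv m d x).2 ⬝ᵥ (euclProdEquiv m d y).2 := by
  simp only [WithLp.prod_inner_apply, PiLp.inner_apply, euclProdEquiv, dotProduct]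
  simp [mul_comm]

/-- The positive exponent of `pairChar` makes this the inverse Fourier transform. -/
theorem charIntegral_euclProdEquiv (g : (Fin m → ℝ) × (Fin d → ℝ) → ℂ) (x : EuclProd m d) :
    charIntegral g (euclProdEquiv m d x) = 𝓕⁻ (g ∘ euclProdEquiv m d) x := by
  rw [charIntegral, ← measurePreserving_euclProdEquiv.integral_comp
    measurableEmbedding_euclProdEquiv, Real.fourierInv_eq']
  refine integral_congr_ae (Filter.Eventually.of_forall fun y => ?_)
  simp only [pairChar, Function.comp_apply, smul_eq_mul, inner_eq_dotProduct]
  congr 2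
  simp only [dotProduct_comm (euclProdEquiv m d x).1, dotProduct_comm (euclProdEquiv m d x).2]
  push_cast
  ring

theorem lintegral_charIntegral_enorm_sq {g : (Fin m → ℝ) × (Fin d → ℝ) → ℂ} (h1 : Integrable g)
    (h2 : MemLp g 2) : ∫⁻ w, ‖charIntegral g w‖ₑ ^ 2 = ∫⁻ p, ‖g p‖ₑ ^ 2 := by
  have mp := measurePreserving_euclProdEquiv (m := m) (d := d)
  have me := measurableEmbedding_euclProdEquiv (m := m) (d := d)
  rw [← mp.lintegral_comp_emb me, ← mp.lintegral_comp_emb me]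
  simp only [charIntegral_euclProdEquiv]
  have := lintegral_fourier_enorm_sq (f := g ∘ euclProdEquiv m d)
    ((mp.integrable_comp_emb me).2 h1) (h2.comp_measurePreserving mp)
  -- The reflection x ↦ -x turns the transform into its inverse and preserves volume.
  rw [← (LinearIsometryEquiv.neg ℝ (E := EuclProd m d)).measurePreserving.lintegral_comp_emb
    (LinearIsometryEquiv.neg ℝ).toHomeomorph.measurableEmbedding] at this
  simpa only [Real.fourierInv_eq_fourier_neg, LinearIsometryEquiv.coe_neg, Function.comp_apply]
    using this

/-- Outside L² the right side is infinite, so the inequality survives without square integrability.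
-/
theorem lintegral_charIntegral_enorm_sq_le {g : (Fin m → ℝ) × (Fin d → ℝ) → ℂ}
    (h1 : Integrable g) : ∫⁻ w, ‖charIntegral g w‖ₑ ^ 2 ≤ ∫⁻ p, ‖g p‖ₑ ^ 2 := by
  by_cases h : eLpNorm g 2 volume < ⊤
  · exact (lintegral_charIntegral_enorm_sq h1 ⟨h1.1, h⟩).le
  · rw [lintegral_enorm_sq_eq g, not_lt_top_iff.1 h]
    simp

/-- A smooth compactly supported function is a Fourier integral. -/
theorem exists_charIntegral_eq {φ : (Fin m → ℝ) × (Fin d → ℝ) → ℝ} (hφ : ContDiff ℝ ∞ φ)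
    (hs : HasCompactSupport φ) : ∃ g : (Fin m → ℝ) × (Fin d → ℝ) → ℂ,
      Integrable g ∧ MemLp g 2 ∧ charIntegral g = fun w => (φ w : ℂ) := by
  set κ := euclProdEquiv m d
  have hs1 : HasCompactSupport (Complex.ofRealCLM ∘ φ ∘ κ) :=
    (hs.comp_homeomorph κ.toHomeomorph).comp_left rfl
  have hs2 : ContDiff ℝ ∞ (Complex.ofRealCLM ∘ φ ∘ κ) := by fun_prop
  set Φ : 𝓢(EuclProd m d, ℂ) := hs1.toSchwartzMap hs2
  have mp := measurePreserving_euclProdEquiv_symm (m := m) (d := d)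
  have me : MeasurableEmbedding κ.symm := κ.symm.toHomeomorph.measurableEmbedding
  refine ⟨(𝓕 Φ : 𝓢(EuclProd m d, ℂ)) ∘ κ.symm,
    (mp.integrable_comp_emb me).2 (𝓕 Φ : 𝓢(EuclProd m d, ℂ)).integrable,
    ((𝓕 Φ : 𝓢(EuclProd m d, ℂ)).memLp 2 volume).comp_measurePreserving mp, ?_⟩
  funext w
  obtain ⟨x, rfl⟩ := κ.surjective w
  rw [charIntegral_euclProdEquiv]
  have : ((𝓕 Φ : 𝓢(EuclProd m d, ℂ)) ∘ κ.symm) ∘ κ = (𝓕 Φ : 𝓢(EuclProd m d, ℂ)) := by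
    ext y; simp
  rw [this, ← SchwartzMap.fourierInv_coe, fourierInv_fourier_eq]
  rfl

end FourierProduct

/-! ### Functions determined by their integrals over rectangles -/

section Rectangles

variable {α β : Type*} [MeasurableSpace α] [MeasurableSpace β] {μ : Measure α} {ν : Measure β}
  [SigmaFinite μ] [SigmaFinite ν]

/-- A function on a product space whose integrals over all rectangles of finite measure vanish is
zero almost everywhere. -/
theorem ae_eq_zero_of_forall_setIntegral_prod_eq_zero {h : α × β → ℂ}
    (hi : ∀ A B, MeasurableSet A → MeasurableSet B → μ A < ⊤ → ν B < ⊤ →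
      IntegrableOn h (A ×ˢ B) (μ.prod ν))
    (h0 : ∀ A B, MeasurableSet A → MeasurableSet B → μ A < ⊤ → ν B < ⊤ →
      ∫ p in A ×ˢ B, h p ∂(μ.prod ν) = 0) : h =ᵐ[μ.prod ν] 0 := by
  have key : ∀ n, h =ᵐ[(μ.prod ν).restrict (spanningSets μ n ×ˢ spanningSets ν n)] 0 := by
    intro n
    set S := spanningSets μ n
    set T := spanningSets ν n
    have hS : MeasurableSet S := measurableSet_spanningSets μ n
    have hT : MeasurableSet T := measurableSet_spanningSets ν n
    have hST : IntegrableOn h (S ×ˢ T) (μ.prod ν) :=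
      hi S T hS hT (measure_spanningSets_lt_top μ n) (measure_spanningSets_lt_top ν n)
    refine Integrable.ae_eq_zero_of_forall_setIntegral_eq_zero hST fun s hs _ => ?_
    rw [Measure.restrict_restrict hs]
    have hr : ∀ A B, MeasurableSet A → MeasurableSet B →
        ∫ p in (A ×ˢ B) ∩ (S ×ˢ T), h p ∂(μ.prod ν) = 0 := fun A B hA hB => by
      rw [Set.prod_inter_prod]
      exact h0 _ _ (hA.inter hS) (hB.inter hT)
        ((measure_mono Set.inter_subset_right).trans_lt (measure_spanningSets_lt_top μ n))
        ((measure_mono Set.inter_subset_right).trans_lt (measure_spanningSets_lt_top ν n))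
    -- A π-λ argument on one rectangle of finite measure. Complements are handled because the
    -- integral over the whole rectangle vanishes too.
    refine MeasurableSpace.induction_on_inter
      (C := fun s _ => ∫ p in s ∩ (S ×ˢ T), h p ∂(μ.prod ν) = 0)
      generateFrom_prod.symm isPiSystem_prod ?_ ?_ ?_ ?_ s hs
    · simp
    · rintro _ ⟨A, hA, B, hB, rfl⟩
      exact hr A B hA hB
    · intro t ht ih
      have h1 := integral_add_compl ht hST.integrable
      rw [Measure.restrict_restrict ht, Measure.restrict_restrict ht.compl, ih, zero_add] at h1
      rw [h1]
      simpa using hr Set.univ Set.univ MeasurableSet.univ MeasurableSet.univ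
    · intro f hd hf ih
      have h1 := integral_iUnion (μ := (μ.prod ν).restrict (S ×ˢ T)) hf hd hST.integrable.integrableOn
      rw [Measure.restrict_restrict (MeasurableSet.iUnion hf)] at h1
      rw [h1]
      simp only [Measure.restrict_restrict (hf _), ih, tsum_zero]
  have hU : ⋃ n, spanningSets μ n ×ˢ spanningSets ν n = Set.univ := by
    refine Set.eq_univ_of_forall fun p => ?_
    have h1 := mem_spanningSetsIndex μ p.1
    have h2 := mem_spanningSetsIndex ν p.2
    exact Set.mem_iUnion.2 ⟨max (spanningSetsIndex μ p.1) (spanningSetsIndex ν p.2),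
      monotone_spanningSets μ (le_max_left _ _) h1, monotone_spanningSets ν (le_max_right _ _) h2⟩
  have := (ae_restrict_iUnion_iff (μ := μ.prod ν)
    (fun n => spanningSets μ n ×ˢ spanningSets ν n) (fun p => h p = 0)).2 key
  rwa [hU, Measure.restrict_univ] at this

omit [SigmaFinite μ] in
theorem MeasureTheory.MemLp.integrableOn_of_measure_lt_top {f : α → ℂ} (hf : MemLp f 2 μ)
    {s : Set α} (hs : μ s < ⊤) : IntegrableOn f s μ := by
  have : IsFiniteMeasure (μ.restrict s) := ⟨by simpa using hs⟩
  exact (hf.restrict s).integrable (by norm_num)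

end Rectangles

/-! ### Fourier transform in one of two variables -/

section PartialFourier

open scoped ContDiff

variable {m d : ℕ} {X : Type*} [MeasureSpace X] [SigmaFinite (volume : Measure X)]

/-- The Fourier integral in the first variable. -/
def partialFourier (f : ((Fin m → ℝ) × (Fin d → ℝ)) × X → ℂ)
    (p : ((Fin m → ℝ) × (Fin d → ℝ)) × X) : ℂ :=
  charIntegral (fun v => f (v, p.2)) p.1

omit [SigmaFinite (volume : Measure X)] in
theorem partialFourier_ae_section [SFinite (volume : Measure X)]
    {f g : ((Fin m → ℝ) × (Fin d → ℝ)) × X → ℂ} (h : f =ᵐ[volume] g) :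
    ∀ᵐ x : X, ∀ w, partialFourier f (w, x) = partialFourier g (w, x) := by
  have h' := Measure.ae_ae_of_ae_prod (Measure.measurePreserving_swap.quasiMeasurePreserving.ae h)
  filter_upwards [h'] with x hx w
  refine integral_congr_ae ?_
  filter_upwards [hx] with p hp
  rw [show f (p, x) = g (p, x) from hp]

theorem partialFourier_congr_ae {f g : ((Fin m → ℝ) × (Fin d → ℝ)) × X → ℂ}
    (h : f =ᵐ[volume] g) : partialFourier f =ᵐ[volume] partialFourier g :=
  (Measure.quasiMeasurePreserving_snd (μ := (volume : Measure ((Fin m → ℝ) × (Fin d → ℝ))))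
    (ν := (volume : Measure X))).ae (partialFourier_ae_section h) |>.mono fun p hp => hp p.1

theorem aestronglyMeasurable_partialFourier {f : ((Fin m → ℝ) × (Fin d → ℝ)) × X → ℂ}
    (hf : AEStronglyMeasurable f) : AEStronglyMeasurable (partialFourier f) := by
  refine AEStronglyMeasurable.congr ?_ (partialFourier_congr_ae hf.ae_eq_mk).symm
  refine StronglyMeasurable.aestronglyMeasurable ?_
  refine StronglyMeasurable.integral_prod_right'
    (f := fun r : (((Fin m → ℝ) × (Fin d → ℝ)) × X) × ((Fin m → ℝ) × (Fin d → ℝ)) =>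
      pairChar r.1.1 r.2 * hf.mk f (r.2, r.1.2)) ?_
  refine StronglyMeasurable.mul ?_ ?_
  · exact (continuous_pairChar.measurable.comp (by fun_prop : Measurable fun
      r : (((Fin m → ℝ) × (Fin d → ℝ)) × X) × ((Fin m → ℝ) × (Fin d → ℝ)) =>
        (r.1.1, r.2))).stronglyMeasurable
  · exact hf.stronglyMeasurable_mk.comp_measurable (by fun_prop)

/-- The partial Fourier transform is isometric on `L¹ ∩ L²`. -/
theorem lintegral_partialFourier_enorm_sq {f : ((Fin m → ℝ) × (Fin d → ℝ)) × X → ℂ}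
    (h1 : Integrable f) (h2 : MemLp f 2) :
    ∫⁻ p, ‖partialFourier f p‖ₑ ^ 2 = ∫⁻ p, ‖f p‖ₑ ^ 2 := by
  have m1 : AEMeasurable (fun p => ‖partialFourier f p‖ₑ ^ 2)
      ((volume : Measure ((Fin m → ℝ) × (Fin d → ℝ))).prod (volume : Measure X)) :=
    (aestronglyMeasurable_partialFourier h1.1).enorm.pow_const _
  have m2 : AEMeasurable (fun p => ‖f p‖ₑ ^ 2)
      ((volume : Measure ((Fin m → ℝ) × (Fin d → ℝ))).prod (volume : Measure X)) :=
    h1.1.enorm.pow_const _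
  have i1 : Integrable f
      ((volume : Measure ((Fin m → ℝ) × (Fin d → ℝ))).prod (volume : Measure X)) := h1
  have i2 : Integrable (fun p => ‖f p‖ ^ 2) := (memLp_two_iff_integrable_sq_norm h1.1).1 h2
  have i3 : Integrable (fun p => ‖f p‖ ^ 2)
      ((volume : Measure ((Fin m → ℝ) × (Fin d → ℝ))).prod (volume : Measure X)) := i2
  refine (lintegral_prod_symm _ m1).trans (Eq.trans ?_ (lintegral_prod_symm _ m2).symm)
  refine lintegral_congr_ae ?_
  filter_upwards [i1.prod_left_ae, i3.prod_left_ae] with x hx1 hx2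
  have hx3 : MemLp (fun v => f (v, x)) 2 volume :=
    (memLp_two_iff_integrable_sq_norm hx1.1).2 hx2
  exact lintegral_charIntegral_enorm_sq (g := fun v => f (v, x)) hx1 hx3

theorem memLp_partialFourier {f : ((Fin m → ℝ) × (Fin d → ℝ)) × X → ℂ}
    (h1 : Integrable f) (h2 : MemLp f 2) : MemLp (partialFourier f) 2 := by
  refine ⟨aestronglyMeasurable_partialFourier h1.1, ?_⟩
  have := lintegral_partialFourier_enorm_sq h1 h2
  rw [lintegral_enorm_sq_eq, lintegral_enorm_sq_eq] at this
  have h3 : eLpNorm (partialFourier f) 2 volume = eLpNorm f 2 volume :=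
    (ENNReal.pow_right_strictMono (n := 2) (by norm_num)).injective this
  rw [h3]
  exact h2.2

/-- The partial Fourier transforms of functions in `L¹ ∩ L²` separate points of `L²`. -/
theorem ae_eq_zero_of_forall_integral_partialFourier_mul_eq_zero
    {h : ((Fin m → ℝ) × (Fin d → ℝ)) × X → ℂ} (hh : MemLp h 2)
    (h0 : ∀ f : ((Fin m → ℝ) × (Fin d → ℝ)) × X → ℂ, Integrable f → MemLp f 2 →
      ∫ p, partialFourier f p * h p = 0) : h =ᵐ[volume] 0 := by
  have hint : ∀ A B, volume A < ⊤ → volume B < ⊤ → IntegrableOn h (A ×ˢ B) volume :=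
    fun A B hA hB => hh.integrableOn_of_measure_lt_top (by
      rw [Measure.volume_eq_prod, Measure.prod_prod]
      exact ENNReal.mul_lt_top hA hB)
  refine ae_eq_zero_of_forall_setIntegral_prod_eq_zero (fun A B _ _ hA hB => hint A B hA hB)
    fun A B hA hB hA' hB' => ?_
  -- With `B` fixed, the partial integral over `B` is tested against smooth functions of the Fourier
  -- variable alone.
  have hloc : LocallyIntegrable (fun v => ∫ x in B, h (v, x)) volume := by
    rw [locallyIntegrable_iff]
    intro K hK
    have := hint K B hK.measure_lt_top hB'
    rw [IntegrableOn, Measure.volume_eq_prod, ← Measure.prod_restrict] at this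
    exact this.integral_prod_left
  have hz : ∀ᵐ v, ∫ x in B, h (v, x) = 0 := by
    refine ae_eq_zero_of_integral_contDiff_smul_eq_zero hloc fun φ hφ hφs => ?_
    -- Since φ is the Fourier integral of `g`, the product of `g` and the indicator of `B` has
    -- partial Fourier transform φ ⊗ 1_B, which is the required test function.
    obtain ⟨g, hg1, hg2, hg⟩ := exists_charIntegral_eq hφ hφs
    have i1 : Integrable (B.indicator fun _ => (1 : ℂ)) (volume : Measure X) :=
      (integrable_indicator_iff hB).2 (integrableOn_const hB'.ne)
    have i2 : MemLp (B.indicator fun _ => (1 : ℂ)) 2 (volume : Measure X) :=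
      memLp_indicator_const 2 hB 1 (Or.inr hB'.ne)
    have hf1 : Integrable (fun p : ((Fin m → ℝ) × (Fin d → ℝ)) × X =>
      g p.1 * B.indicator (fun _ => (1 : ℂ)) p.2) := hg1.mul_prod i1
    have hf2 : MemLp (fun p : ((Fin m → ℝ) × (Fin d → ℝ)) × X =>
        g p.1 * B.indicator (fun _ => (1 : ℂ)) p.2) 2 := by
      rw [memLp_two_iff_integrable_sq_norm hf1.1]
      refine (((memLp_two_iff_integrable_sq_norm hg1.1).1 hg2).mul_prod
        ((memLp_two_iff_integrable_sq_norm i1.1).1 i2)).congr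
        (Filter.Eventually.of_forall fun p => ?_)
      simp [mul_pow]
    have h1 := h0 _ hf1 hf2
    have hpf : ∀ p : ((Fin m → ℝ) × (Fin d → ℝ)) × X, partialFourier
        (fun p : ((Fin m → ℝ) × (Fin d → ℝ)) × X => g p.1 * B.indicator (fun _ => (1 : ℂ)) p.2) p
          = φ p.1 * B.indicator (fun _ => (1 : ℂ)) p.2 := fun p => by
      rw [← congrFun hg p.1]
      simp only [partialFourier, charIntegral, ← mul_assoc]
      rw [integral_mul_const]
    have i3 : Integrable (fun p => partialFourier (fun p : ((Fin m → ℝ) × (Fin d → ℝ)) × X =>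
        g p.1 * B.indicator (fun _ => (1 : ℂ)) p.2) p * h p)
        ((volume : Measure ((Fin m → ℝ) × (Fin d → ℝ))).prod (volume : Measure X)) :=
      (memLp_partialFourier hf1 hf2).integrable_mul hh
    rw [← h1]
    refine Eq.trans ?_ (integral_prod _ i3).symm
    refine integral_congr_ae (Filter.Eventually.of_forall fun v => ?_)
    simp only [hpf, Complex.real_smul]
    rw [← integral_indicator hB, ← integral_const_mul]
    refine integral_congr_ae (Filter.Eventually.of_forall fun x => ?_)
    by_cases hx : x ∈ B <;> simp [hx]
  have i4 := hint A B hA' hB'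
  rw [Measure.volume_eq_prod] at i4
  rw [setIntegral_prod _ i4]
  exact integral_eq_zero_of_ae (ae_restrict_of_ae hz)

end PartialFourier

/-- An almost everywhere left inverse is what is available here: `freqMap` and `kernelMap` are
inverted only over the cross-section. -/
theorem MeasureTheory.MeasurePreserving.of_ae_leftInverse {α β : Type*} [MeasurableSpace α]
    [MeasurableSpace β] {μ : Measure α} {ν : Measure β} {f : α → β} {g : β → α}
    (hf : MeasurePreserving f μ ν) (hg : Measurable g) (h : ∀ᵐ x ∂μ, g (f x) = x) :
    MeasurePreserving g ν μ := by
  refine ⟨hg, ?_⟩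
  rw [← hf.map_eq, Measure.map_map hg hf.measurable,
    Measure.map_congr (g := id) (by filter_upwards [h] with x hx using hx), Measure.map_id]

/-! ### The cross-section, the Plancherel measure and the frequency map -/

namespace AdaptedBasis

variable {𝔫 : Type*} [LieRing 𝔫] [LieAlgebra ℝ 𝔫] {m d : ℕ} (e : AdaptedBasis 𝔫 m d)

theorem functional_apply (ℓ : Fin m → ℝ) (v : 𝔫) : e.functional ℓ v = ℓ ⬝ᵥ e.zRepr v := by
  simp [functional, dotProduct, zRepr]

theorem continuous_matrixV : Continuous e.matrixV := by
  refine continuous_matrix fun i j => ?_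
  simp only [matrixV, Matrix.of_apply, functional_apply, dotProduct]
  fun_prop

theorem continuous_matrixB : Continuous e.matrixB := by
  refine continuous_matrix fun i j => ?_
  simp only [matrixB, Matrix.of_apply, functional_apply, dotProduct]
  fun_prop

theorem measurableSet_crossSection : MeasurableSet e.crossSection :=
  (isOpen_ne.preimage e.continuous_matrixV.matrix_det).measurableSet

/-- The diagonal blocks vanish because the Y_j commute with each other and so do the X_j. -/
theorem matrixV_eq_fromBlocks (ℓ : Fin m → ℝ) :
    e.matrixV ℓ = Matrix.fromBlocks 0 (e.matrixB ℓ)ᵀ (-e.matrixB ℓ) 0 := by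
  ext i j
  rcases i with i | i <;> rcases j with j | j
  · simp [matrixV, e.lie_Y]
  · rw [Matrix.fromBlocks_apply₁₂, matrixV, Matrix.of_apply, ← lie_skew]
    simp only [matrixB, X, Y, Matrix.transpose_apply, Matrix.of_apply, map_neg]
  · simp [matrixV, matrixB, X, Y]
  · simp [matrixV, e.lie_X]

/-- If B(ℓ) kills y, then V(ℓ) kills (y, 0). -/
theorem det_matrixB_ne_zero {ℓ : Fin m → ℝ} (h : ℓ ∈ e.crossSection) :
    (e.matrixB ℓ).det ≠ 0 := by
  intro h0
  refine h ?_
  obtain ⟨y, hy, hBy⟩ := Matrix.exists_mulVec_eq_zero_iff.2 h0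
  refine Matrix.exists_mulVec_eq_zero_iff.1 ⟨Sum.elim y 0, ?_, ?_⟩
  · intro hz
    exact hy (funext fun i => congrFun hz (Sum.inl i))
  · rw [matrixV_eq_fromBlocks, Matrix.fromBlocks_mulVec]
    ext i
    rcases i with i | i <;> simp [Matrix.neg_mulVec, hBy]

theorem matrixV_add (ℓ ℓ' : Fin m → ℝ) : e.matrixV (ℓ + ℓ') = e.matrixV ℓ + e.matrixV ℓ' := by
  ext i j
  simp [matrixV, functional_apply, add_dotProduct]

theorem matrixV_smul (c : ℝ) (ℓ : Fin m → ℝ) : e.matrixV (c • ℓ) = c • e.matrixV ℓ := by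
  ext i j
  simp [matrixV, functional_apply, smul_dotProduct]

theorem volume_preimage_matrix_mulVec {M : Matrix (Fin d) (Fin d) ℝ} (hM : M.det ≠ 0)
    {s : Set (Fin d → ℝ)} (hs : MeasurableSet s) :
    ENNReal.ofReal |M.det| * volume ((fun t => M *ᵥ t) ⁻¹' s) = volume s := by
  have h := congrArg (fun μ => μ s) (Real.map_matrix_volume_pi_eq_smul_volume_pi hM)
  have hm : Measurable (Matrix.toLin' M) :=
    (LinearMap.continuous_of_finiteDimensional _).measurable
  simp only [Measure.map_apply hm hs, Measure.smul_apply, smul_eq_mul] at h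
  change ENNReal.ofReal |M.det| * volume (Matrix.toLin' M ⁻¹' s) = volume s
  rw [h, ← mul_assoc, ← ENNReal.ofReal_mul (abs_nonneg _), ← abs_mul, mul_inv_cancel₀ hM]
  simp

instance : SigmaFinite e.plancherelMeasure :=
  SigmaFinite.withDensity_ofReal _

theorem ae_plancherelMeasure_mem_crossSection :
    ∀ᵐ ℓ ∂e.plancherelMeasure, ℓ ∈ e.crossSection :=
  (withDensity_absolutelyContinuous _ _).ae_le (ae_restrict_mem e.measurableSet_crossSection)

theorem measurable_density : Measurable fun ℓ => ENNReal.ofReal |(e.matrixB ℓ).det| :=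
  (e.continuous_matrixB.matrix_det.abs.measurable).ennreal_ofReal

/-! ### The change of variables between integral kernels and partial Fourier transforms -/

/-- `(ℓ, t) ↦ (ℓ, B(ℓ)ᵀ t)` -/
def freqMap (p : (Fin m → ℝ) × (Fin d → ℝ)) : (Fin m → ℝ) × (Fin d → ℝ) :=
  (p.1, (e.matrixB p.1)ᵀ *ᵥ p.2)

/-- `(ℓ, ξ) ↦ (ℓ, B(ℓ)⁻ᵀ ξ)` -/
def freqInv (p : (Fin m → ℝ) × (Fin d → ℝ)) : (Fin m → ℝ) × (Fin d → ℝ) :=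
  (p.1, ((e.matrixB p.1)ᵀ)⁻¹ *ᵥ p.2)

theorem measurable_freqMap : Measurable e.freqMap := by
  refine Continuous.measurable ?_
  have := e.continuous_matrixB
  exact continuous_fst.prodMk
    ((this.comp continuous_fst).matrix_transpose.matrix_mulVec continuous_snd)

/-- Inversion is not continuous where det B(ℓ) = 0, but Cramer's rule exhibits it as a measurable
scalar times a continuous adjugate. -/
theorem measurable_freqInv : Measurable e.freqInv := by
  refine measurable_fst.prodMk ?_
  have hc := e.continuous_matrixB.comp
    (continuous_fst : Continuous (Prod.fst : (Fin m → ℝ) × (Fin d → ℝ) → _))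
  have h1 : Measurable fun p : (Fin m → ℝ) × (Fin d → ℝ) => ((e.matrixB p.1)ᵀ).det⁻¹ :=
    hc.matrix_transpose.matrix_det.measurable.inv
  have h2 : Measurable fun p : (Fin m → ℝ) × (Fin d → ℝ) =>
      ((e.matrixB p.1)ᵀ).adjugate *ᵥ p.2 :=
    (hc.matrix_transpose.matrix_adjugate.matrix_mulVec continuous_snd).measurable
  simp only [Matrix.inv_def, Ring.inverse_eq_inv', Matrix.smul_mulVec]
  exact h1.smul h2

theorem freqInv_freqMap {p : (Fin m → ℝ) × (Fin d → ℝ)} (h : p.1 ∈ e.crossSection) :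
    e.freqInv (e.freqMap p) = p := by
  have hu : IsUnit ((e.matrixB p.1)ᵀ).det := by
    rw [Matrix.det_transpose]; exact isUnit_iff_ne_zero.2 (e.det_matrixB_ne_zero h)
  simp [freqInv, freqMap, Matrix.mulVec_mulVec, Matrix.nonsing_inv_mul _ hu]

theorem freqMap_freqInv {p : (Fin m → ℝ) × (Fin d → ℝ)} (h : p.1 ∈ e.crossSection) :
    e.freqMap (e.freqInv p) = p := by
  have hu : IsUnit ((e.matrixB p.1)ᵀ).det := by
    rw [Matrix.det_transpose]; exact isUnit_iff_ne_zero.2 (e.det_matrixB_ne_zero h)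
  simp [freqInv, freqMap, Matrix.mulVec_mulVec, Matrix.mul_nonsing_inv _ hu]

theorem ae_mem_crossSection_of_prod {β : Type*} [MeasurableSpace β] (ν : Measure β) :
    ∀ᵐ p ∂(e.plancherelMeasure.prod ν), p.1 ∈ e.crossSection :=
  Measure.quasiMeasurePreserving_fst.ae e.ae_plancherelMeasure_mem_crossSection

/-- `(ℓ, (t, s)) ↦ ((ℓ, B(ℓ)ᵀ t), t - s)` -/
def kernelMap (p : (Fin m → ℝ) × Plane d) : ((Fin m → ℝ) × (Fin d → ℝ)) × (Fin d → ℝ) :=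
  (e.freqMap (p.1, p.2.1), p.2.1 - p.2.2)

/-- The inverse of `kernelMap` over the cross-section. -/
def kernelInv (p : ((Fin m → ℝ) × (Fin d → ℝ)) × (Fin d → ℝ)) : (Fin m → ℝ) × Plane d :=
  (p.1.1, ((e.freqInv p.1).2, (e.freqInv p.1).2 - p.2))

theorem measurable_kernelInv : Measurable e.kernelInv := by
  have h : Measurable fun p : ((Fin m → ℝ) × (Fin d → ℝ)) × (Fin d → ℝ) => (e.freqInv p.1).2 :=
    (e.measurable_freqInv.comp measurable_fst).snd
  exact measurable_fst.fst.prodMk (h.prodMk (h.sub measurable_snd))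

theorem kernelInv_kernelMap {p : (Fin m → ℝ) × Plane d} (h : p.1 ∈ e.crossSection) :
    e.kernelInv (e.kernelMap p) = p := by
  have h1 := e.freqInv_freqMap (p := (p.1, p.2.1)) h
  simp only [kernelInv, kernelMap, h1]
  simp [freqMap]

theorem measurePreserving_sub_snd :
    MeasurePreserving (fun p : Plane d => (p.1, p.1 - p.2)) volume volume :=
  (MeasurePreserving.id volume).skew_product (g := fun t s : Fin d → ℝ => t - s)
    (by simp only [Function.uncurry_def]; fun_prop)
    (Filter.Eventually.of_forall fun t => (Measure.measurePreserving_sub_left volume t).map_eq)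

section TwoStep

variable [TwoStepLie 𝔫]

/-- The values on the Z_k of a functional whose radical is the center give a point of Σ. If c is in
the left kernel of V, then ∑ c_i E_i lies in the radical, hence in the span of the Z_k, which forces
c = 0. -/
theorem crossSection_nonempty : e.crossSection.Nonempty := by
  obtain ⟨f, hf⟩ := e.exists_flat
  refine ⟨fun k => f (e.Z k), ?_⟩
  set ℓ : Fin m → ℝ := fun k => f (e.Z k)
  have hfun : ∀ v w : 𝔫, e.functional ℓ ⁅v, w⁆ = f ⁅v, w⁆ := fun v w => by
    rw [functional_apply]
    conv_rhs => rw [← e.zVec_zRepr (lie_mem_center v w)]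
    simp [zVec, dotProduct, ℓ, mul_comm]
  intro h0
  obtain ⟨c, hc, hVc⟩ := Matrix.exists_vecMul_eq_zero_iff.2 h0
  refine hc ?_
  set v : 𝔫 := ∑ i, c i • e.basis (Sum.inr i)
  have hv : ∀ j, f ⁅v, e.basis (Sum.inr j)⁆ = 0 := fun j => by
    have := congrFun hVc j
    simpa [Matrix.vecMul, dotProduct, matrixV, hfun, v, sum_lie] using this
  have hcen : v ∈ LieAlgebra.center ℝ 𝔫 := by
    refine (hf v).1 fun w => ?_
    rw [← e.basis.sum_repr w, Fintype.sum_sum_type, lie_add]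
    have h1 : ⁅v, ∑ k, e.basis.repr w (Sum.inl k) • e.basis (Sum.inl k)⁆ = 0 :=
      e.lie_zVec v (e.zRepr w)
    rw [h1, zero_add, lie_sum, map_sum]
    simp [hv]
  have h2 := e.zVec_zRepr hcen
  funext i
  have h3 := congrArg (fun x => e.basis.repr x (Sum.inr i)) h2
  have h4 : e.basis.repr (e.zVec (e.zRepr v)) (Sum.inr i) = 0 := by
    simp [zVec, Z]
  have h5 : e.basis.repr v (Sum.inr i) = c i := by
    simp only [v, map_sum, map_smul, Module.Basis.repr_self, Finsupp.coe_finsetSum,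
      Finset.sum_apply, Finsupp.smul_apply, Finsupp.single_apply, Sum.inr.injEq, smul_eq_mul,
      mul_ite, mul_one, mul_zero, Finset.sum_ite_eq', Finset.mem_univ, if_true]
  exact h5.symm.trans (h3.symm.trans h4)

/-- On each line ℓ + cℓ₀ with ℓ₀ in Σ, det V equals det V(ℓ₀) times the characteristic polynomial of
-V(ℓ₀)⁻¹V(ℓ) at c. That polynomial is monic, so each line meets the complement of Σ in finitely many
points. -/
theorem ae_mem_crossSection : ∀ᵐ ℓ : Fin m → ℝ, ℓ ∈ e.crossSection := by
  obtain ⟨ℓ₀, h₀⟩ := e.crossSection_nonempty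
  refine ae_mem_of_ae_add_linearMap_mem (LinearMap.toSpanSingleton ℝ (Fin m → ℝ) ℓ₀) volume
    volume e.measurableSet_crossSection fun ℓ => ?_
  set A := e.matrixV ℓ₀
  set p : Polynomial ℝ := (-((A⁻¹) * e.matrixV ℓ)).charpoly with hp
  have hu : IsUnit A.det := isUnit_iff_ne_zero.2 h₀
  have hsub : {c : ℝ | ¬ ℓ + LinearMap.toSpanSingleton ℝ (Fin m → ℝ) ℓ₀ c ∈ e.crossSection} ⊆
      {c | p.IsRoot c} := by
    intro c hc
    simp only [crossSection, Set.mem_ofPred_eq, not_not, LinearMap.toSpanSingleton_apply,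
      matrixV_add, matrixV_smul] at hc
    have h1 : e.matrixV ℓ + c • A = A * (Matrix.scalar _ c - -(A⁻¹ * e.matrixV ℓ)) := by
      rw [mul_sub, mul_neg, ← mul_assoc, Matrix.mul_nonsing_inv A hu, one_mul]
      simp [Matrix.scalar_apply, ← Matrix.smul_one_eq_diagonal, add_comm]
    rw [h1, Matrix.det_mul] at hc
    simpa [Polynomial.IsRoot, hp, Matrix.eval_charpoly, h₀] using
      (mul_eq_zero.1 hc).resolve_left h₀
  exact measure_mono_null hsub
    ((Polynomial.finite_setOfPred_isRoot (Matrix.charpoly_monic _).ne_zero).measure_zero _)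

theorem plancherelMeasure_eq_withDensity :
    e.plancherelMeasure = volume.withDensity fun ℓ => ENNReal.ofReal |(e.matrixB ℓ).det| := by
  rw [plancherelMeasure, Measure.restrict_eq_self_of_ae_mem e.ae_mem_crossSection]

theorem plancherelMeasure_lt_top {I : Set (Fin m → ℝ)} {c : Fin m → ℝ}
    (h : I ⊆ Set.Icc 0 c) : e.plancherelMeasure I < ⊤ := by
  rw [plancherelMeasure_eq_withDensity]
  have := IsLocallyFiniteMeasure.withDensity_ofReal (μ := (volume : Measure (Fin m → ℝ)))
    e.continuous_matrixB.matrix_det.abs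
  exact (measure_mono h).trans_lt isCompact_Icc.measure_lt_top

/-- For fixed ℓ the map t ↦ B(ℓ)ᵀt has Jacobian |det B(ℓ)|, and the density of μ compensates exactly
for it. -/
theorem measurePreserving_freqMap :
    MeasurePreserving e.freqMap (e.plancherelMeasure.prod volume) volume := by
  refine ⟨e.measurable_freqMap, Measure.ext fun s hs => ?_⟩
  rw [Measure.map_apply e.measurable_freqMap hs,
    Measure.prod_apply (e.measurable_freqMap hs), Measure.volume_eq_prod, Measure.prod_apply hs,
    plancherelMeasure_eq_withDensity, lintegral_withDensity_eq_lintegral_mul _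
      e.measurable_density (measurable_measure_prodMk_left (e.measurable_freqMap hs))]
  refine lintegral_congr_ae ?_
  filter_upwards [e.ae_mem_crossSection] with ℓ hℓ
  have hM : ((e.matrixB ℓ)ᵀ).det ≠ 0 := by
    rw [Matrix.det_transpose]; exact e.det_matrixB_ne_zero hℓ
  have := volume_preimage_matrix_mulVec hM (measurable_prodMk_left (x := ℓ) hs)
  rw [Matrix.det_transpose] at this
  exact this

theorem measurePreserving_freqInv :
    MeasurePreserving e.freqInv volume (e.plancherelMeasure.prod volume) := by
  refine e.measurePreserving_freqMap.of_ae_leftInverse e.measurable_freqInv ?_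
  filter_upwards [Measure.quasiMeasurePreserving_fst.ae e.ae_plancherelMeasure_mem_crossSection]
    with p hp using e.freqInv_freqMap hp

theorem measurePreserving_kernelMap :
    MeasurePreserving e.kernelMap (e.plancherelMeasure.prod volume) volume := by
  have h2 := (MeasurePreserving.id e.plancherelMeasure).prod (measurePreserving_sub_snd (d := d))
  have h3 := (measurePreserving_prodAssoc e.plancherelMeasure (volume : Measure (Fin d → ℝ))
    (volume : Measure (Fin d → ℝ))).symm
  have h4 := e.measurePreserving_freqMap.prod (MeasurePreserving.id (volume : Measure (Fin d → ℝ)))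
  exact h4.comp (h3.comp h2)

theorem measurePreserving_kernelInv :
    MeasurePreserving e.kernelInv volume (e.plancherelMeasure.prod volume) := by
  refine e.measurePreserving_kernelMap.of_ae_leftInverse e.measurable_kernelInv ?_
  filter_upwards [e.ae_mem_crossSection_of_prod volume] with p hp using e.kernelInv_kernelMap hp

/-- The chart `((z, y), x) ↦ exp (∑ z_k Z_k) exp (∑ y_j Y_j) exp (∑ x_j X_j)`. -/
def assocChart (p : ((Fin m → ℝ) × (Fin d → ℝ)) × (Fin d → ℝ)) : NilGroup 𝔫 :=
  e.ofCoords (p.1.1, p.1.2, p.2)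

theorem measurePreserving_assocChart : MeasurePreserving e.assocChart volume e.haar :=
  e.measurePreserving_ofCoords.comp (measurePreserving_prodAssoc (volume : Measure (Fin m → ℝ))
    (volume : Measure (Fin d → ℝ)) (volume : Measure (Fin d → ℝ)))

theorem measurableEmbedding_assocChart : MeasurableEmbedding e.assocChart :=
  e.chart.measurableEmbedding.comp MeasurableEquiv.prodAssoc.measurableEmbedding

end TwoStep

end AdaptedBasis

/-! ### Integral kernels of the operators ∫ f(n) π_ℓ(n) dn -/

namespace AdaptedBasis

variable {𝔫 : Type*} [LieRing 𝔫] [LieAlgebra ℝ 𝔫] {m d : ℕ} (e : AdaptedBasis 𝔫 m d)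

/-- A square-integrable kernel is determined by its sesquilinear form. -/
theorem ae_eq_of_kernelForm_eq {k k' : Plane d → ℂ} (hk : MemLp k 2 volume)
    (hk' : MemLp k' 2 volume) (h : ∀ g h : L2R d, kernelForm k g h = kernelForm k' g h) :
    k =ᵐ[volume] k' := by
  have hd := hk.sub hk'
  suffices (k - k') =ᵐ[(volume : Measure (Fin d → ℝ)).prod volume] 0 by
    filter_upwards [this] with p hp
    exact sub_eq_zero.1 hp
  have hprod : ∀ A B : Set (Fin d → ℝ), volume A < ⊤ → volume B < ⊤ →
      (volume : Measure (Plane d)) (A ×ˢ B) < ⊤ := fun A B hA hB => by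
    rw [Measure.volume_eq_prod, Measure.prod_prod]
    exact ENNReal.mul_lt_top hA hB
  refine ae_eq_zero_of_forall_setIntegral_prod_eq_zero
    (fun A B _ _ hA hB => hd.integrableOn_of_measure_lt_top (hprod A B hA hB))
    fun A B hA hB hA' hB' => ?_
  set g : L2R d := indicatorConstLp 2 hA hA'.ne 1
  set g' : L2R d := indicatorConstLp 2 hB hB'.ne 1
  have hind : ∀ k : Plane d → ℂ, kernelForm k g g' = ∫ p in A ×ˢ B, k p := fun k => by
    rw [kernelForm, ← integral_indicator (hA.prod hB)]
    refine integral_congr_ae ?_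
    have h1 := (Measure.quasiMeasurePreserving_fst (μ := (volume : Measure (Fin d → ℝ)))
      (ν := (volume : Measure (Fin d → ℝ)))).ae
      (indicatorConstLp_coeFn (p := 2) (hs := hA) (hμs := hA'.ne) (c := (1 : ℂ)))
    have h2 := (Measure.quasiMeasurePreserving_snd (μ := (volume : Measure (Fin d → ℝ)))
      (ν := (volume : Measure (Fin d → ℝ)))).ae
      (indicatorConstLp_coeFn (p := 2) (hs := hB) (hμs := hB'.ne) (c := (1 : ℂ)))
    filter_upwards [h1, h2] with p hp1 hp2
    rw [hp1, hp2]
    by_cases hp : p.1 ∈ A <;> by_cases hp' : p.2 ∈ B <;> simp [hp, hp', Set.indicator, Set.mem_prod]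
  have h3 := h g g'
  rw [hind, hind] at h3
  refine Eq.trans (integral_sub (f := k) (g := k')
    (hk.integrableOn_of_measure_lt_top (hprod A B hA' hB'))
    (hk'.integrableOn_of_measure_lt_top (hprod A B hA' hB'))) ?_
  exact sub_eq_zero.2 h3

/-- Transposing B(ℓ) from y to t turns the phase of π_ℓ into a character of (z, y) with frequency
(ℓ, B(ℓ)ᵀt); this is the origin of `freqMap`. -/
theorem phase_eq (ℓ : Fin m → ℝ) (p : Coords m d) (t : Fin d → ℝ) :
    Complex.exp (2 * Real.pi * Complex.I * e.phase ℓ p t) =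
      pairChar (e.freqMap (ℓ, t)) (p.1, p.2.1) := by
  rw [pairChar, freqMap, phase]
  simp only [Matrix.mulVec_transpose, Matrix.dotProduct_mulVec]

/-- The bound does not depend on x, so it supplies the integrability that Fubini needs for the
matrix coefficients. -/
theorem integrable_conj_mul_translate (g h : L2R d) (x : Fin d → ℝ) :
    Integrable (fun t => (starRingEnd ℂ) (g t) * h (t - x)) ∧
      ∫ t, ‖(starRingEnd ℂ) (g t) * h (t - x)‖ ≤ (∫ t, ‖g t‖ ^ 2) + ∫ t, ‖h t‖ ^ 2 := by
  have mp := measurePreserving_sub_right (volume : Measure (Fin d → ℝ)) x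
  have hg := (memLp_two_iff_integrable_sq_norm (Lp.aestronglyMeasurable g)).1 (Lp.memLp g)
  have hh := (memLp_two_iff_integrable_sq_norm (Lp.aestronglyMeasurable h)).1 (Lp.memLp h)
  have hh' : Integrable (fun t => ‖h (t - x)‖ ^ 2) := hh.comp_sub_right x
  have hm : AEStronglyMeasurable (fun t => (starRingEnd ℂ) (g t) * h (t - x)) volume :=
    (Complex.continuous_conj.comp_aestronglyMeasurable (Lp.aestronglyMeasurable g)).mul
      ((Lp.aestronglyMeasurable h).comp_measurePreserving mp)
  have hle : ∀ t, ‖(starRingEnd ℂ) (g t) * h (t - x)‖ ≤ ‖g t‖ ^ 2 + ‖h (t - x)‖ ^ 2 := fun t => by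
    rw [norm_mul, RCLike.norm_conj]
    nlinarith [sq_nonneg (‖g t‖ - ‖h (t - x)‖), sq_nonneg ‖g t‖, sq_nonneg ‖h (t - x)‖]
  have hi : Integrable (fun t => (starRingEnd ℂ) (g t) * h (t - x)) :=
    (hg.add hh').mono' hm (Filter.Eventually.of_forall hle)
  refine ⟨hi, (integral_mono hi.norm (hg.add hh') hle).trans_eq ?_⟩
  rw [← integral_sub_right_eq_self (fun t => ‖h t‖ ^ 2) x]
  exact integral_add hg hh'

/-- Exchanging the integrals in the matrix coefficient of an integrated representation. -/
theorem integral_mul_integral_eq_kernelForm {α : Type*} [MeasurableSpace α] {μ : Measure α}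
    [SigmaFinite μ] {F : α × (Fin d → ℝ) → ℂ} (hF : Integrable F (μ.prod volume))
    {c : (Fin d → ℝ) → α → ℂ} (hc : Measurable (Function.uncurry c)) (hc1 : ∀ t v, ‖c t v‖ = 1)
    (g h : L2R d) :
    ∫ q, F q * (∫ t, c t q.1 * ((starRingEnd ℂ) (g t) * h (t - q.2))) ∂(μ.prod volume) =
      kernelForm (fun p => ∫ v, c p.1 v * F (v, p.1 - p.2) ∂μ) g h := by
  set Ψ : (α × (Fin d → ℝ)) × (Fin d → ℝ) → ℂ := fun r =>
    F r.1 * (c r.2 r.1.1 * ((starRingEnd ℂ) (g r.2) * h (r.2 - r.1.2)))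
  have hg : Measurable g := (Lp.stronglyMeasurable g).measurable
  have hh : Measurable h := (Lp.stronglyMeasurable h).measurable
  have hnorm : ∀ q t, ‖Ψ (q, t)‖ = ‖F q‖ * ‖(starRingEnd ℂ) (g t) * h (t - q.2)‖ := fun q t => by
    simp only [Ψ, norm_mul, hc1, one_mul]
  have hΨm : AEStronglyMeasurable Ψ ((μ.prod volume).prod volume) := by
    refine AEStronglyMeasurable.mul hF.1.comp_fst (Measurable.aestronglyMeasurable ?_)
    refine Measurable.mul ?_ (Measurable.mul ?_ ?_)
    · exact hc.comp (measurable_snd.prodMk measurable_fst.fst)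
    · exact Complex.continuous_conj.measurable.comp (hg.comp measurable_snd)
    · exact hh.comp (by fun_prop)
  set C := (∫ t, ‖g t‖ ^ 2) + ∫ t, ‖h t‖ ^ 2
  have hΨ : Integrable Ψ ((μ.prod volume).prod volume) := by
    rw [integrable_prod_iff hΨm]
    constructor
    · refine Filter.Eventually.of_forall fun q => ?_
      refine Integrable.const_mul ?_ (F q)
      refine ((integrable_conj_mul_translate g h q.2).1).bdd_mul (c := 1) ?_ ?_
      · exact (hc.comp (measurable_id.prodMk
          (measurable_const (a := q.1)))).aestronglyMeasurable
      · exact Filter.Eventually.of_forall fun t => (hc1 _ _).le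
    · refine (hF.norm.mul_const C).mono' hΨm.norm.integral_prod_right' ?_
      refine Filter.Eventually.of_forall fun q => ?_
      simp only [hnorm]
      rw [integral_const_mul, Real.norm_of_nonneg (mul_nonneg (norm_nonneg _)
        (integral_nonneg fun _ => norm_nonneg _))]
      exact mul_le_mul_of_nonneg_left (integrable_conj_mul_translate g h q.2).2 (norm_nonneg _)
  have hR : ∫ q, F q * (∫ t, c t q.1 * ((starRingEnd ℂ) (g t) * h (t - q.2))) ∂(μ.prod volume) =
      ∫ r, Ψ r ∂((μ.prod volume).prod volume) := by
    rw [integral_prod _ hΨ]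
    refine integral_congr_ae (Filter.Eventually.of_forall fun q => ?_)
    exact (integral_const_mul _ _).symm
  -- τ sends ((t, x), v) to ((v, x), t), so that the inner integral becomes the one over v.
  set τ : (Plane d) × α ≃ᵐ (α × (Fin d → ℝ)) × (Fin d → ℝ) := MeasurableEquiv.prodComm.trans
    (((MeasurableEquiv.refl α).prodCongr MeasurableEquiv.prodComm).trans
      MeasurableEquiv.prodAssoc.symm)
  have hτ : MeasurePreserving τ ((volume : Measure (Plane d)).prod μ)
      ((μ.prod volume).prod volume) := by
    have h2 : MeasurePreserving ((MeasurableEquiv.refl α).prodCongr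
        (MeasurableEquiv.prodComm : Plane d ≃ᵐ Plane d)) (μ.prod volume) (μ.prod volume) :=
      (MeasurePreserving.id μ).prod Measure.measurePreserving_swap
    exact ((measurePreserving_prodAssoc μ volume volume).symm).comp
      (h2.comp Measure.measurePreserving_swap)
  have hΨ' : Integrable (fun r => Ψ (τ r)) ((volume : Measure (Plane d)).prod μ) :=
    (hτ.integrable_comp_emb τ.measurableEmbedding).2 hΨ
  have hS : ∫ r, Ψ r ∂((μ.prod volume).prod volume) = ∫ p : Plane d, ∫ v, Ψ (τ (p, v)) ∂μ :=
    (hτ.integral_comp τ.measurableEmbedding Ψ).symm.trans (integral_prod _ hΨ')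
  have hme : MeasurableEmbedding (fun p : Plane d => (p.1, p.1 - p.2)) :=
    MeasurableEquiv.measurableEmbedding
      { toFun := fun p : Plane d => (p.1, p.1 - p.2)
        invFun := fun p : Plane d => (p.1, p.1 - p.2)
        left_inv := fun p => by simp
        right_inv := fun p => by simp
        measurable_toFun := by simp only [Equiv.coe_fn_mk]; fun_prop
        measurable_invFun := by simp only [Equiv.coe_fn_symm_mk]; fun_prop }
  -- The involution (t, s) ↦ (t, t - s) substitutes x = t - s, and h(t - x) becomes h(s).
  rw [hR, hS, ← measurePreserving_sub_snd.integral_comp hme, kernelForm]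
  refine integral_congr_ae (Filter.Eventually.of_forall fun p => ?_)
  change ∫ v, F (v, p.1 - p.2) * (c p.1 v *
    ((starRingEnd ℂ) (g p.1) * h (p.1 - (p.1 - p.2)))) ∂μ = _
  simp only [sub_sub_cancel]
  rw [← integral_mul_const]
  refine integral_congr_ae (Filter.Eventually.of_forall fun v => ?_)
  ring

section TwoStep

variable [TwoStepLie 𝔫]

theorem coeff_assocChart (ℓ : Fin m → ℝ) (g h : L2R d)
    (q : ((Fin m → ℝ) × (Fin d → ℝ)) × (Fin d → ℝ)) : e.coeff ℓ g h (e.assocChart q) =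
      ∫ t, pairChar (e.freqMap (ℓ, t)) q.1 * ((starRingEnd ℂ) (g t) * h (t - q.2)) := by
  rw [coeff, L2.inner_def]
  refine integral_congr_ae ?_
  filter_upwards [e.coeFn_rep ℓ (e.assocChart q) h] with t ht
  rw [RCLike.inner_apply, ht, phase_eq, assocChart, toCoords_ofCoords]
  ring

end TwoStep
end AdaptedBasis

namespace AdaptedBasis

variable {𝔫 : Type*} [LieRing 𝔫] [LieAlgebra ℝ 𝔫] {m d : ℕ} (e : AdaptedBasis 𝔫 m d)

section TwoStep

variable [TwoStepLie 𝔫]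

/-- The integral kernel of the operator `∫ f(n) π_ℓ(n) dn`, for integrable `f`. -/
theorem kernelForm_partialFourier {f : NilGroup 𝔫 → ℂ} (hf : Integrable f e.haar)
    (ℓ : Fin m → ℝ) (g h : L2R d) :
    kernelForm (fun p => partialFourier (f ∘ e.assocChart) (e.kernelMap (ℓ, p))) g h =
      ∫ n, f n * e.coeff ℓ g h n ∂e.haar := by
  have hFi : Integrable (f ∘ e.assocChart) :=
    (e.measurePreserving_assocChart.integrable_comp_emb e.measurableEmbedding_assocChart).2 hf
  have hfm : Measurable fun t : Fin d → ℝ => e.freqMap (ℓ, t) :=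
    e.measurable_freqMap.comp measurable_prodMk_left
  have hc : Measurable (Function.uncurry fun t v => pairChar (e.freqMap (ℓ, t)) v) :=
    measurable_pairChar_comp (hfm.comp measurable_fst) measurable_snd
  have key := integral_mul_integral_eq_kernelForm (μ := (volume : Measure ((Fin m → ℝ) ×
    (Fin d → ℝ)))) (F := f ∘ e.assocChart) hFi hc (fun t v => norm_pairChar _ _) g h
  have h2 : ∫ q, f (e.assocChart q) * e.coeff ℓ g h (e.assocChart q) =
      ∫ n, f n * e.coeff ℓ g h n ∂e.haar :=
    e.measurePreserving_assocChart.integral_comp e.measurableEmbedding_assocChart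
      fun n => f n * e.coeff ℓ g h n
  simp only [coeff_assocChart] at h2
  exact key.symm.trans h2

/-- The Fourier transform on `L¹(N) ∩ L²(N)` is a partial Fourier transform, up to the change of
variables `kernelMap`. -/
theorem mem_fourierGraph_iff (f : e.L2N) (K : e.L2Sigma) : (f, K) ∈ e.fourierGraph ↔
    Integrable f e.haar ∧ K =ᵐ[e.plancherelMeasure.prod volume]
      fun p => partialFourier (f ∘ e.assocChart) (e.kernelMap p) := by
  refine and_congr_right fun hf => ?_
  have hF1 : Integrable (f ∘ e.assocChart) :=
    (e.measurePreserving_assocChart.integrable_comp_emb e.measurableEmbedding_assocChart).2 hf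
  have hF2 : MemLp (f ∘ e.assocChart) 2 :=
    (Lp.memLp f).comp_measurePreserving e.measurePreserving_assocChart
  set k : (Fin m → ℝ) × Plane d → ℂ :=
    fun p => partialFourier (f ∘ e.assocChart) (e.kernelMap p)
  have hk : MemLp k 2 (e.plancherelMeasure.prod volume) :=
    (memLp_partialFourier hF1 hF2).comp_measurePreserving e.measurePreserving_kernelMap
  have hk2 : ∀ᵐ ℓ ∂e.plancherelMeasure, MemLp (fun p => k (ℓ, p)) 2 volume := by
    have h1 := ((memLp_two_iff_integrable_sq_norm hk.1).1 hk).prod_right_ae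
    filter_upwards [h1, hk.1.prodMk_left] with ℓ h2 h3
    exact (memLp_two_iff_integrable_sq_norm h3).2 h2
  constructor
  · intro h
    have hmk : ∀ᵐ ℓ ∂e.plancherelMeasure, ∀ᵐ p, K (ℓ, p) = hk.1.mk k (ℓ, p) := by
      filter_upwards [h, hk2, Measure.ae_ae_of_ae_prod hk.1.ae_eq_mk] with ℓ h1 h2 h3
      filter_upwards [ae_eq_of_kernelForm_eq h1.1 h2 fun g h => (h1.2 g h).trans
        (e.kernelForm_partialFourier hf ℓ g h).symm, h3] with p hp1 hp2
      exact hp1.trans hp2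
    -- Equality on almost every fibre gives joint almost everywhere equality only for a measurable
    -- set, hence the detour through a measurable representative of `k`.
    have hms : MeasurableSet {p | K p = hk.1.mk k p} := measurableSet_eq_fun
      (Lp.stronglyMeasurable K).measurable hk.1.stronglyMeasurable_mk.measurable
    have := (Measure.ae_prod_mem_iff_ae_ae_mem hms).2 hmk
    filter_upwards [this, hk.1.ae_eq_mk] with p h1 h2
    exact h1.trans h2.symm
  · intro h
    filter_upwards [Measure.ae_ae_of_ae_prod h, hk2] with ℓ h1 h2
    refine ⟨h2.ae_eq (Filter.EventuallyEq.symm h1), fun g g' => ?_⟩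
    rw [← e.kernelForm_partialFourier hf ℓ g g']
    refine integral_congr_ae ?_
    filter_upwards [h1] with p hp
    rw [hp]

/-- The chart and `kernelMap` preserve measure, and the partial Fourier transform between them is
isometric. -/
theorem norm_eq_of_mem_fourierGraph {x : e.L2N × e.L2Sigma} (h : x ∈ e.fourierGraph) :
    ‖x.2‖ = ‖x.1‖ := by
  obtain ⟨hf, hK⟩ := (e.mem_fourierGraph_iff x.1 x.2).1 h
  have hF1 : Integrable (x.1 ∘ e.assocChart) :=
    (e.measurePreserving_assocChart.integrable_comp_emb e.measurableEmbedding_assocChart).2 hf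
  have hF2 : MemLp (x.1 ∘ e.assocChart) 2 :=
    (Lp.memLp x.1).comp_measurePreserving e.measurePreserving_assocChart
  have h1 := lintegral_partialFourier_enorm_sq hF1 hF2
  rw [lintegral_enorm_sq_eq, lintegral_enorm_sq_eq] at h1
  have h2 := (ENNReal.pow_right_strictMono (n := 2) (by norm_num)).injective h1
  rw [Lp.norm_def, Lp.norm_def, eLpNorm_congr_ae hK,
    ← eLpNorm_comp_measurePreserving (Lp.aestronglyMeasurable x.1) e.measurePreserving_assocChart,
    ← h2, ← eLpNorm_comp_measurePreserving (memLp_partialFourier hF1 hF2).1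
      e.measurePreserving_kernelMap]
  rfl

end TwoStep
end AdaptedBasis

/-! ### The Plancherel theorem: isometry and surjectivity -/

theorem MeasureTheory.MeasurePreserving.integral_comp_of_aestronglyMeasurable {α β : Type*}
    [MeasurableSpace α] [MeasurableSpace β] {μ : Measure α} {ν : Measure β} {f : α → β}
    (hf : MeasurePreserving f μ ν) {g : β → ℂ} (hg : AEStronglyMeasurable g ν) :
    ∫ x, g (f x) ∂μ = ∫ y, g y ∂ν := by
  rw [← hf.map_eq] at hg ⊢
  exact (integral_map hf.aemeasurable hg).symm

namespace AdaptedBasis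

variable {𝔫 : Type*} [LieRing 𝔫] [LieAlgebra ℝ 𝔫] {m d : ℕ} (e : AdaptedBasis 𝔫 m d)

section TwoStep

variable [TwoStepLie 𝔫]

/-- The inverse of `assocChart`. -/
def assocCoords (n : NilGroup 𝔫) : ((Fin m → ℝ) × (Fin d → ℝ)) × (Fin d → ℝ) :=
  (((e.toCoords n).1, (e.toCoords n).2.1), (e.toCoords n).2.2)

theorem measurePreserving_assocCoords : MeasurePreserving e.assocCoords e.haar volume :=
  (measurePreserving_prodAssoc (volume : Measure (Fin m → ℝ))
    (volume : Measure (Fin d → ℝ)) (volume : Measure (Fin d → ℝ))).symm.comp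
    e.measurePreserving_toCoords

theorem assocCoords_assocChart (q : ((Fin m → ℝ) × (Fin d → ℝ)) × (Fin d → ℝ)) :
    e.assocCoords (e.assocChart q) = q := by
  simp [assocCoords, assocChart, toCoords_ofCoords]

/-- Equality of the two norms is a closed condition, so it passes to the closure of the graph. -/
theorem norm_eq_of_mem_plancherelGraph {x : e.L2N × e.L2Sigma} (h : x ∈ e.plancherelGraph) :
    ‖x.2‖ = ‖x.1‖ := by
  have hc : IsClosed {x : e.L2N × e.L2Sigma | ‖x.2‖ = ‖x.1‖} :=
    isClosed_eq continuous_snd.norm continuous_fst.norm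
  exact closure_minimal (fun y hy => e.norm_eq_of_mem_fourierGraph hy) hc h

/-- The Plancherel theorem. -/
theorem inner_eq_of_mem_plancherelGraph {x y : e.L2N × e.L2Sigma} (hx : x ∈ e.plancherelGraph)
    (hy : y ∈ e.plancherelGraph) : inner ℂ x.2 y.2 = inner ℂ x.1 y.1 := by
  have h1 := e.norm_eq_of_mem_plancherelGraph (add_mem hx hy)
  have h2 := e.norm_eq_of_mem_plancherelGraph (sub_mem hx hy)
  have h3 := e.norm_eq_of_mem_plancherelGraph
    (sub_mem hx (Submodule.smul_mem _ (Complex.I) hy))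
  have h4 := e.norm_eq_of_mem_plancherelGraph
    (add_mem hx (Submodule.smul_mem _ (Complex.I) hy))
  rw [inner_eq_sum_norm_sq_div_four, inner_eq_sum_norm_sq_div_four]
  simp only [Prod.fst_add, Prod.snd_add, Prod.fst_sub, Prod.snd_sub, Prod.smul_fst,
    Prod.smul_snd] at h1 h2 h3 h4
  simp only [RCLike.I_to_complex, h1, h2, h3, h4]

/-- A kernel field orthogonal to all Fourier transforms vanishes. -/
theorem eq_zero_of_forall_inner_eq_zero {K : e.L2Sigma}
    (hK : ∀ x ∈ e.fourierGraph, inner ℂ x.2 K = 0) : K = 0 := by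
  set h : ((Fin m → ℝ) × (Fin d → ℝ)) × (Fin d → ℝ) → ℂ :=
    fun q => (starRingEnd ℂ) (K (e.kernelInv q))
  have hh : MemLp h 2 := ((Lp.memLp K).comp_measurePreserving e.measurePreserving_kernelInv).star
  have hinv : ∀ᵐ p ∂(e.plancherelMeasure.prod volume), K (e.kernelInv (e.kernelMap p)) = K p := by
    filter_upwards [e.ae_mem_crossSection_of_prod volume] with p hp
    rw [e.kernelInv_kernelMap hp]
  have h0 : h =ᵐ[volume] 0 := by
    -- In the variables of `kernelMap`, every F in L¹ ∩ L² comes from a function on the group, so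
    -- orthogonality to all Fourier transforms is orthogonality to all partial Fourier transforms.
    refine ae_eq_zero_of_forall_integral_partialFourier_mul_eq_zero hh fun F hF1 hF2 => ?_
    have hf1 : Integrable (F ∘ e.assocCoords) e.haar :=
      e.measurePreserving_assocCoords.integrable_comp_of_integrable hF1
    have hf2 : MemLp (F ∘ e.assocCoords) 2 e.haar :=
      hF2.comp_measurePreserving e.measurePreserving_assocCoords
    have hp := memLp_partialFourier hF1 hF2
    have hk := hp.comp_measurePreserving e.measurePreserving_kernelMap
    have hfF : (hf2.toLp _ : NilGroup 𝔫 → ℂ) ∘ e.assocChart =ᵐ[volume] F := by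
      filter_upwards [e.measurePreserving_assocChart.quasiMeasurePreserving.ae hf2.coeFn_toLp]
        with q hq
      rw [Function.comp_apply, hq, Function.comp_apply, assocCoords_assocChart]
    have hmem : (hf2.toLp _, hk.toLp _) ∈ e.fourierGraph := by
      rw [mem_fourierGraph_iff]
      refine ⟨hf1.congr hf2.coeFn_toLp.symm, hk.coeFn_toLp.trans ?_⟩
      exact (e.measurePreserving_kernelMap.quasiMeasurePreserving.ae
        (partialFourier_congr_ae hfF)).mono fun p hp => hp.symm
    have hz := hK _ hmem
    rw [L2.inner_def] at hz
    refine (e.measurePreserving_kernelMap.integral_comp_of_aestronglyMeasurable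
      (hp.1.mul hh.1)).symm.trans ?_
    rw [← map_zero (starRingEnd ℂ), ← hz, ← integral_conj]
    refine integral_congr_ae ?_
    filter_upwards [hk.coeFn_toLp, hinv] with p hp1 hp2
    simp only [RCLike.inner_apply, hp1, Function.comp_apply, map_mul, Pi.mul_apply, h, hp2]
    simp [mul_comm]
  rw [Lp.eq_zero_iff_ae_eq_zero]
  filter_upwards [hinv, e.measurePreserving_kernelMap.quasiMeasurePreserving.ae h0] with p h1 h2
  rw [← h1]
  simpa [h] using h2

/-- The Plancherel transform is onto. -/
theorem exists_mem_plancherelGraph (K : e.L2Sigma) : ∃ f, (f, K) ∈ e.plancherelGraph := by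
  set φ : e.plancherelGraph → e.L2Sigma := fun x => x.1.2
  have hφ : Isometry φ := by
    refine Isometry.of_dist_eq fun x y => ?_
    have h := e.norm_eq_of_mem_plancherelGraph (sub_mem x.2 y.2)
    -- The product norm is a maximum, and both components have the same norm, so the projection to
    -- the second one is isometric on the graph. Its range is therefore closed.
    rw [Subtype.dist_eq, dist_eq_norm, dist_eq_norm, Prod.norm_def, ← h, max_self]
    rfl
  have : CompleteSpace e.plancherelGraph := Submodule.topologicalClosure.completeSpace _
  set R : Submodule ℂ e.L2Sigma := e.plancherelGraph.map (LinearMap.snd ℂ e.L2N e.L2Sigma)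
  have hR : IsClosed (R : Set e.L2Sigma) := by
    have : (R : Set e.L2Sigma) = Set.range φ := by
      ext K
      simp [R, φ]
    rw [this]
    exact hφ.isClosedEmbedding.isClosed_range
  have : CompleteSpace R := hR.completeSpace_coe
  have hbot : Rᗮ = ⊥ := by
    rw [Submodule.eq_bot_iff]
    intro K hK
    refine e.eq_zero_of_forall_inner_eq_zero fun x hx => ?_
    exact hK x.2 ⟨x, Submodule.le_topologicalClosure _ hx, rfl⟩
  have htop : R = ⊤ := Submodule.orthogonal_eq_bot_iff.1 hbot
  obtain ⟨x, hx, rfl⟩ : K ∈ R := htop ▸ Submodule.mem_top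
  exact ⟨x.1, hx⟩

end TwoStep
end AdaptedBasis

/-! ### Equivariance of the Plancherel transform under left translation -/

section Twist

variable {α : Type*} [MeasurableSpace α] {μ : Measure α}

theorem memLp_twist {c : α → ℂ} (hc : Measurable c) (hc1 : ∀ x, ‖c x‖ = 1) {T : α → α}
    (hT : MeasurePreserving T μ μ) (F : Lp ℂ 2 μ) : MemLp (fun x => c x * F (T x)) 2 μ := by
  have h := (Lp.memLp F).comp_measurePreserving hT
  refine h.of_le (hc.aestronglyMeasurable.mul h.1) (Filter.Eventually.of_forall fun x => ?_)
  rw [norm_mul, hc1, one_mul, Function.comp_apply]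

/-- The isometry `F ↦ c · (F ∘ T)` of `L²(μ)`, for a unimodular function `c` and a measure
preserving map `T`. -/
def twist (c : α → ℂ) (hc : Measurable c) (hc1 : ∀ x, ‖c x‖ = 1) (T : α → α)
    (hT : MeasurePreserving T μ μ) : Lp ℂ 2 μ →ₗᵢ[ℂ] Lp ℂ 2 μ where
  toFun F := (memLp_twist hc hc1 hT F).toLp _
  map_add' F G := by
    rw [← MemLp.toLp_add]
    refine MemLp.toLp_congr _ _ ?_
    filter_upwards [hT.quasiMeasurePreserving.ae (Lp.coeFn_add F G)] with x hx
    rw [hx, Pi.add_apply, Pi.add_apply, mul_add]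
  map_smul' a F := by
    rw [RingHom.id_apply, ← MemLp.toLp_const_smul]
    refine MemLp.toLp_congr _ _ ?_
    filter_upwards [hT.quasiMeasurePreserving.ae (Lp.coeFn_smul a F)] with x hx
    rw [hx, Pi.smul_apply, Pi.smul_apply, smul_eq_mul, smul_eq_mul]
    ring
  norm_map' F := by
    change ‖(memLp_twist hc hc1 hT F).toLp _‖ = ‖F‖
    rw [Lp.norm_toLp, Lp.norm_def,
      ← eLpNorm_comp_measurePreserving (Lp.aestronglyMeasurable F) hT]
    congr 1
    refine eLpNorm_congr_norm_ae (Filter.Eventually.of_forall fun x => ?_)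
    rw [norm_mul, hc1, one_mul, Function.comp_apply]

theorem coeFn_twist {c : α → ℂ} (hc : Measurable c) (hc1 : ∀ x, ‖c x‖ = 1) {T : α → α}
    (hT : MeasurePreserving T μ μ) (F : Lp ℂ 2 μ) :
    twist c hc hc1 T hT F =ᵐ[μ] fun x => c x * F (T x) :=
  (memLp_twist hc hc1 hT F).coeFn_toLp

end Twist

namespace AdaptedBasis

variable {𝔫 : Type*} [LieRing 𝔫] [LieAlgebra ℝ 𝔫] {m d : ℕ} (e : AdaptedBasis 𝔫 m d)

theorem measurable_zRepr_lie (v : 𝔫) : Measurable fun y : Fin d → ℝ => e.zRepr ⁅v, e.yVec y⁆ := by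
  refine measurable_pi_lambda _ fun k => ?_
  simp only [zRepr, yVec, lie_sum, lie_smul, map_sum, map_smul, Finsupp.coe_finsetSum,
    Finset.sum_apply, Finsupp.smul_apply, smul_eq_mul]
  fun_prop

theorem dotProduct_zRepr_lie (ℓ : Fin m → ℝ) (x y : Fin d → ℝ) :
    ℓ ⬝ᵥ e.zRepr ⁅e.xVec x, e.yVec y⁆ = -(x ⬝ᵥ (e.matrixB ℓ *ᵥ y)) := by
  rw [← functional_apply]
  simp only [xVec, yVec, sum_lie, lie_sum, smul_lie, lie_smul, map_sum, map_smul, smul_eq_mul,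
    dotProduct, mulVec, matrixB, Matrix.of_apply, Finset.mul_sum]
  rw [← Finset.sum_neg_distrib, Finset.sum_comm]
  refine Finset.sum_congr rfl fun i _ => ?_
  rw [← Finset.sum_neg_distrib]
  refine Finset.sum_congr rfl fun j _ => ?_
  ring

/-- Left translation in the coordinates `(z, y)`. -/
def shiftEquiv (g : Coords m d) :
    ((Fin m → ℝ) × (Fin d → ℝ)) ≃ᵐ ((Fin m → ℝ) × (Fin d → ℝ)) where
  toFun v := (v.1 + (g.1 + e.zRepr ⁅e.xVec g.2.2, e.yVec v.2⁆), v.2 + g.2.1)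
  invFun v := (v.1 - (g.1 + e.zRepr ⁅e.xVec g.2.2, e.yVec (v.2 - g.2.1)⁆), v.2 - g.2.1)
  left_inv v := by simp
  right_inv v := by simp
  measurable_toFun :=
    (measurable_fst.add (measurable_const.add
      ((e.measurable_zRepr_lie (e.xVec g.2.2)).comp measurable_snd))).prodMk
        (measurable_snd.add measurable_const)
  measurable_invFun :=
    (measurable_fst.sub (measurable_const.add ((e.measurable_zRepr_lie (e.xVec g.2.2)).comp
      (measurable_snd.sub measurable_const)))).prodMk (measurable_snd.sub measurable_const)

theorem measurePreserving_shiftEquiv (g : Coords m d) :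
    MeasurePreserving (e.shiftEquiv g) volume volume := by
  have hm := e.measurable_zRepr_lie (e.xVec g.2.2)
  have h := MeasurePreserving.skew_product (μa := (volume : Measure (Fin d → ℝ)))
    (μb := volume) (μc := (volume : Measure (Fin m → ℝ))) (μd := volume)
    (measurePreserving_add_right volume g.2.1)
    (g := fun y z => z + (g.1 + e.zRepr ⁅e.xVec g.2.2, e.yVec y⁆))
    (measurable_snd.add (measurable_const.add (hm.comp measurable_fst)))
    (Filter.Eventually.of_forall fun r => (measurePreserving_add_right volume _).map_eq)
  exact (Measure.measurePreserving_swap.comp h).comp Measure.measurePreserving_swap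

/-- The commutator of the X-part of g with the Y-part of v contributes -⟨x, B(ℓ)y⟩ to the phase,
which is the effect of replacing t by t - x. This is the multiplicativity of π_ℓ. -/
theorem pairChar_shiftEquiv (g : Coords m d) (ℓ : Fin m → ℝ) (t : Fin d → ℝ)
    (v : (Fin m → ℝ) × (Fin d → ℝ)) :
    pairChar (e.freqMap (ℓ, t)) (e.shiftEquiv g v) =
      pairChar (e.freqMap (ℓ, t)) (g.1, g.2.1) * pairChar (e.freqMap (ℓ, t - g.2.2)) v := by
  have h1 : ∀ (s y : Fin d → ℝ), ((e.matrixB ℓ)ᵀ *ᵥ s) ⬝ᵥ y = s ⬝ᵥ (e.matrixB ℓ *ᵥ y) :=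
    fun s y => by rw [Matrix.mulVec_transpose, Matrix.dotProduct_mulVec]
  simp only [pairChar, freqMap, shiftEquiv, MeasurableEquiv.coe_mk, Equiv.coe_fn_mk]
  rw [← Complex.exp_add, ← mul_add, ← Complex.ofReal_add]
  congr 3
  simp only [h1, dotProduct_add, dotProduct_zRepr_lie, Matrix.mulVec_add, sub_dotProduct]
  ring

/-- The map `(ℓ, (t, s)) ↦ (ℓ, (t - x, s))`. -/
theorem measurePreserving_kernelShift (x : Fin d → ℝ) :
    MeasurePreserving (fun p : (Fin m → ℝ) × Plane d => (p.1, (p.2.1 - x, p.2.2)))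
      (e.plancherelMeasure.prod volume) (e.plancherelMeasure.prod volume) :=
  (MeasurePreserving.id _).prod
    ((measurePreserving_sub_right volume x).prod (MeasurePreserving.id _))

theorem measurable_pairChar_freqMap (g : Coords m d) :
    Measurable fun p : (Fin m → ℝ) × Plane d => pairChar (e.freqMap (p.1, p.2.1)) (g.1, g.2.1) :=
  measurable_pairChar_comp
    (e.measurable_freqMap.comp (measurable_fst.prodMk measurable_snd.fst)) measurable_const

/-- The action of `N` on fields of integral kernels: `K(ℓ) ↦ π_ℓ(n) K(ℓ)`, where `n` has the
coordinates `g`. -/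
def kernelAction (g : Coords m d) : e.L2Sigma →ₗᵢ[ℂ] e.L2Sigma :=
  twist (fun p => pairChar (e.freqMap (p.1, p.2.1)) (g.1, g.2.1)) (e.measurable_pairChar_freqMap g)
    (fun _ => norm_pairChar _ _) _ (e.measurePreserving_kernelShift g.2.2)

theorem coeFn_kernelAction (g : Coords m d) (K : e.L2Sigma) :
    e.kernelAction g K =ᵐ[e.plancherelMeasure.prod volume] fun p =>
      pairChar (e.freqMap (p.1, p.2.1)) (g.1, g.2.1) * K (p.1, (p.2.1 - g.2.2, p.2.2)) :=
  coeFn_twist _ _ _ K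

/-- Undoing the translation in (z, y) under the integral leaves the action of π_ℓ(g) on the first
variable of the kernel. -/
theorem partialFourier_shift (g : Coords m d)
    (F : ((Fin m → ℝ) × (Fin d → ℝ)) × (Fin d → ℝ) → ℂ) (p : (Fin m → ℝ) × Plane d) :
    partialFourier (fun q => F ((e.shiftEquiv g).symm q.1, q.2 - g.2.2)) (e.kernelMap p) =
      pairChar (e.freqMap (p.1, p.2.1)) (g.1, g.2.1) *
        partialFourier F (e.kernelMap (p.1, (p.2.1 - g.2.2, p.2.2))) := by
  simp only [partialFourier, charIntegral, kernelMap]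
  rw [← (e.measurePreserving_shiftEquiv g).integral_comp (e.shiftEquiv g).measurableEmbedding,
    ← integral_const_mul]
  refine integral_congr_ae (Filter.Eventually.of_forall fun v => ?_)
  simp only [pairChar_shiftEquiv, MeasurableEquiv.symm_apply_apply, mul_assoc,
    sub_right_comm p.2.1 p.2.2]

/-- The group acts on the left factor only: v ⊗ u becomes (π_ℓ(g)v) ⊗ u. -/
theorem kernelAction_mem_rankOneField (g : Coords m d) {I : Set (Fin m → ℝ)} {u : L2R d}
    {K : e.L2Sigma} (hK : K ∈ e.rankOneField I u) : e.kernelAction g K ∈ e.rankOneField I u := by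
  have hK' : ∀ᵐ ℓ ∂e.plancherelMeasure,
    (ℓ ∈ I → ∃ v : L2R d, ∀ᵐ p : Plane d, K (ℓ, p) = v p.1 * (starRingEnd ℂ) (u p.2)) ∧
    (ℓ ∉ I → ∀ᵐ p : Plane d, K (ℓ, p) = 0) := hK
  have mp : MeasurePreserving (fun p : Plane d => (p.1 - g.2.2, p.2)) volume volume :=
    (measurePreserving_sub_right volume g.2.2).prod (MeasurePreserving.id _)
  change ∀ᵐ ℓ ∂e.plancherelMeasure, _
  filter_upwards [hK', Measure.ae_ae_of_ae_prod (e.coeFn_kernelAction g K)] with ℓ h1 h2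
  refine ⟨fun hI => ?_, fun hI => ?_⟩
  · obtain ⟨v, hv⟩ := h1.1 hI
    have hm : Measurable fun t => pairChar (e.freqMap (ℓ, t)) (g.1, g.2.1) :=
      measurable_pairChar_comp (e.measurable_freqMap.comp measurable_prodMk_left) measurable_const
    have mp' := measurePreserving_sub_right (volume : Measure (Fin d → ℝ)) g.2.2
    refine ⟨twist _ hm (fun _ => norm_pairChar _ _) _ mp' v, ?_⟩
    have h3 := (Measure.quasiMeasurePreserving_fst (μ := (volume : Measure (Fin d → ℝ)))
      (ν := (volume : Measure (Fin d → ℝ)))).ae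
      (coeFn_twist hm (fun _ => norm_pairChar _ _) mp' v)
    filter_upwards [h2, mp.quasiMeasurePreserving.ae hv, h3] with p hp1 hp2 hp3
    rw [hp1, hp2, hp3, mul_assoc]
  · filter_upwards [h2, mp.quasiMeasurePreserving.ae (h1.2 hI)] with p hp1 hp2
    rw [hp1, hp2, mul_zero]

section TwoStep

variable [TwoStepLie 𝔫]

theorem ofCoords_mul_assocChart (g : Coords m d)
    (q : ((Fin m → ℝ) × (Fin d → ℝ)) × (Fin d → ℝ)) : e.ofCoords g * e.assocChart q =
      e.assocChart (e.shiftEquiv g q.1, q.2 + g.2.2) :=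
  e.ofCoords_mul g (q.1.1, q.1.2, q.2)

theorem coeFn_leftRegular (n : NilGroup 𝔫) (f : e.L2N) :
    e.leftRegular n f =ᵐ[e.haar] fun n' => f (n⁻¹ * n') :=
  Lp.coeFn_compMeasurePreserving f (e.measurePreserving_mul_left n⁻¹)

theorem inv_ofCoords_mul_assocChart (g : Coords m d)
    (q : ((Fin m → ℝ) × (Fin d → ℝ)) × (Fin d → ℝ)) : (e.ofCoords g)⁻¹ * e.assocChart q =
      e.assocChart ((e.shiftEquiv g).symm q.1, q.2 - g.2.2) := by
  rw [inv_mul_eq_iff_eq_mul, ofCoords_mul_assocChart]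
  simp

theorem leftRegular_mem_fourierGraph (g : Coords m d) {x : e.L2N × e.L2Sigma}
    (h : x ∈ e.fourierGraph) :
    (e.leftRegular (e.ofCoords g) x.1, e.kernelAction g x.2) ∈ e.fourierGraph := by
  obtain ⟨h1, h2⟩ := (e.mem_fourierGraph_iff x.1 x.2).1 h
  have hL := e.coeFn_leftRegular (e.ofCoords g) x.1
  refine (e.mem_fourierGraph_iff _ _).2 ⟨?_, ?_⟩
  · exact ((e.measurePreserving_mul_left (e.ofCoords g)⁻¹).integrable_comp_of_integrable h1).congr
      hL.symm
  · have hF : (e.leftRegular (e.ofCoords g) x.1 : NilGroup 𝔫 → ℂ) ∘ e.assocChart =ᵐ[volume]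
        fun q => (x.1 ∘ e.assocChart) ((e.shiftEquiv g).symm q.1, q.2 - g.2.2) := by
      filter_upwards [e.measurePreserving_assocChart.quasiMeasurePreserving.ae hL] with q hq
      rw [Function.comp_apply, hq, inv_ofCoords_mul_assocChart, Function.comp_apply]
    filter_upwards [e.coeFn_kernelAction g x.2,
      (e.measurePreserving_kernelShift g.2.2).quasiMeasurePreserving.ae h2,
      e.measurePreserving_kernelMap.quasiMeasurePreserving.ae (partialFourier_congr_ae hF)]
      with p hp1 hp2 hp3
    rw [hp1, hp2, hp3, partialFourier_shift]

/-- The Plancherel transform intertwines the left regular representation with `⊕ π_ℓ ⊗ 1`. -/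
theorem leftRegular_mem_plancherelGraph (g : Coords m d) {x : e.L2N × e.L2Sigma}
    (h : x ∈ e.plancherelGraph) :
    (e.leftRegular (e.ofCoords g) x.1, e.kernelAction g x.2) ∈ e.plancherelGraph := by
  have hc : Continuous fun x : e.L2N × e.L2Sigma =>
      (e.leftRegular (e.ofCoords g) x.1, e.kernelAction g x.2) :=
    ((e.leftRegular _).continuous.comp continuous_fst).prodMk
      ((e.kernelAction g).continuous.comp continuous_snd)
  exact map_mem_closure (f := fun x : e.L2N × e.L2Sigma =>
    (e.leftRegular (e.ofCoords g) x.1, e.kernelAction g x.2)) hc h fun y hy =>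
      e.leftRegular_mem_fourierGraph g hy

theorem leftRegular_mem_bandLimitedSpace (n : NilGroup 𝔫) {I : Set (Fin m → ℝ)} {u : L2R d}
    {f : e.L2N} (hf : f ∈ e.bandLimitedSpace I u) :
    e.leftRegular n f ∈ e.bandLimitedSpace I u := by
  obtain ⟨x, ⟨hx1, hx2⟩, rfl⟩ := hf
  have h := e.leftRegular_mem_plancherelGraph (e.toCoords n) hx1
  rw [ofCoords_toCoords] at h
  exact ⟨_, ⟨h, e.kernelAction_mem_rankOneField _ hx2⟩, rfl⟩

theorem leftRegular_mul_apply (n n' : NilGroup 𝔫) (f : e.L2N) :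
    e.leftRegular (n * n') f = e.leftRegular n (e.leftRegular n' f) := by
  refine Lp.ext ?_
  filter_upwards [e.coeFn_leftRegular (n * n') f, e.coeFn_leftRegular n (e.leftRegular n' f),
    (e.measurePreserving_mul_left n⁻¹).quasiMeasurePreserving.ae (e.coeFn_leftRegular n' f)]
    with p h1 h2 h3
  rw [h1, h2, h3, _root_.mul_inv_rev, mul_assoc]

end TwoStep
end AdaptedBasis

/-! ### Square integrability of matrix coefficients -/

section CauchySchwarz

variable {α : Type*} [MeasurableSpace α] {μ : Measure α}

theorem enorm_integral_mul_sq_le {f g : α → ℂ} (hf : AEStronglyMeasurable f μ)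
    (hg : AEStronglyMeasurable g μ) :
    ‖∫ x, f x * g x ∂μ‖ₑ ^ 2 ≤ (∫⁻ x, ‖f x‖ₑ ^ 2 ∂μ) * ∫⁻ x, ‖g x‖ₑ ^ 2 ∂μ := by
  have h1 : ‖∫ x, f x * g x ∂μ‖ₑ ≤ ∫⁻ x, ‖f x‖ₑ * ‖g x‖ₑ ∂μ := by
    refine (enorm_integral_le_lintegral_enorm _).trans_eq ?_
    simp only [enorm_mul]
  have h2 := ENNReal.lintegral_mul_le_Lp_mul_Lq μ Real.HolderConjugate.two_two hf.enorm hg.enorm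
  refine (pow_le_pow_left₀ zero_le (h1.trans h2) 2).trans_eq ?_
  rw [mul_pow, ← ENNReal.rpow_natCast, ← ENNReal.rpow_natCast, ← ENNReal.rpow_mul,
    ← ENNReal.rpow_mul]
  norm_num

end CauchySchwarz

namespace AdaptedBasis

variable {𝔫 : Type*} [LieRing 𝔫] [LieAlgebra ℝ 𝔫] {m d : ℕ} (e : AdaptedBasis 𝔫 m d)

theorem lintegral_enorm_sq_eq_one {u : L2R d} (hu : ‖u‖ = 1) : ∫⁻ t, ‖u t‖ₑ ^ 2 = 1 := by
  rw [lintegral_enorm_sq_eq, ← Lp.enorm_def, ← ofReal_norm, hu]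
  simp

/-- The field of kernels `1_I(ℓ) u(t) conj (u(s))` of the projections onto `u`. -/
def projectionField (I : Set (Fin m → ℝ)) (u : L2R d) (p : (Fin m → ℝ) × Plane d) : ℂ :=
  I.indicator (fun _ => (1 : ℂ)) p.1 * (u p.2.1 * (starRingEnd ℂ) (u p.2.2))

theorem measurable_projectionField {I : Set (Fin m → ℝ)} (hI : MeasurableSet I) (u : L2R d) :
    Measurable (projectionField I u) := by
  have hu : Measurable u := (Lp.stronglyMeasurable u).measurable
  exact ((measurable_const.indicator hI).comp measurable_fst).mul
    ((hu.comp measurable_snd.fst).mul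
      (Complex.continuous_conj.measurable.comp (hu.comp measurable_snd.snd)))

/-- Each fibre over I is u ⊗ u, of Hilbert-Schmidt norm 1, so the total mass is μ(I). -/
theorem lintegral_projectionField {I : Set (Fin m → ℝ)} (hI : MeasurableSet I) {u : L2R d}
    (hu : ‖u‖ = 1) : ∫⁻ p, ‖projectionField I u p‖ₑ ^ 2 ∂(e.plancherelMeasure.prod volume) =
      e.plancherelMeasure I := by
  have hum : AEMeasurable (fun t => ‖u t‖ₑ ^ 2) volume :=
    (Lp.aestronglyMeasurable u).enorm.pow_const _
  have h1 : ∫⁻ p : Plane d, ‖u p.1‖ₑ ^ 2 * ‖u p.2‖ₑ ^ 2 = 1 := by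
    rw [Measure.volume_eq_prod, lintegral_prod_mul hum hum, lintegral_enorm_sq_eq_one hu, one_mul]
  have h2 : ∀ p, ‖projectionField I u p‖ₑ ^ 2 =
      I.indicator (fun _ => (1 : ℝ≥0∞)) p.1 * (‖u p.2.1‖ₑ ^ 2 * ‖u p.2.2‖ₑ ^ 2) := fun p => by
    by_cases hp : p.1 ∈ I <;> simp [projectionField, hp, mul_pow]
  have hm1 : AEMeasurable (I.indicator fun _ => (1 : ℝ≥0∞)) e.plancherelMeasure :=
    (measurable_const.indicator hI).aemeasurable
  have hm2 : AEMeasurable (fun p : Plane d => ‖u p.1‖ₑ ^ 2 * ‖u p.2‖ₑ ^ 2) volume :=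
    hum.comp_fst.mul hum.comp_snd
  rw [lintegral_congr h2]
  refine (lintegral_prod_mul hm1 hm2).trans ?_
  rw [h1, mul_one, lintegral_indicator hI]
  simp

theorem memLp_projectionField {I : Set (Fin m → ℝ)} (hI : MeasurableSet I)
    (hI' : e.plancherelMeasure I < ⊤) {u : L2R d} (hu : ‖u‖ = 1) :
    MemLp (projectionField I u) 2 (e.plancherelMeasure.prod volume) := by
  refine ⟨(measurable_projectionField hI u).aestronglyMeasurable, ?_⟩
  have h := e.lintegral_projectionField hI hu
  rw [lintegral_enorm_sq_eq] at h
  by_contra h3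
  rw [not_lt_top_iff.1 h3] at h
  simp [← h] at hI'

theorem toLp_projectionField_mem_rankOneField {I : Set (Fin m → ℝ)} {u : L2R d}
    (h : MemLp (projectionField I u) 2 (e.plancherelMeasure.prod volume)) :
    h.toLp _ ∈ e.rankOneField I u := by
  change ∀ᵐ ℓ ∂e.plancherelMeasure, _
  filter_upwards [Measure.ae_ae_of_ae_prod h.coeFn_toLp] with ℓ hℓ
  refine ⟨fun hI => ⟨u, ?_⟩, fun hI => ?_⟩
  · filter_upwards [hℓ] with p hp
    rw [hp]
    simp [projectionField, hI]
  · filter_upwards [hℓ] with p hp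
    rw [hp]
    simp [projectionField, hI]

/-- The contraction `(ℓ, t) ↦ ∫ K(ℓ, t, s) u(s) ds` of a kernel field with `u`. -/
def contraction (K : e.L2Sigma) (u : L2R d) (p : (Fin m → ℝ) × (Fin d → ℝ)) : ℂ :=
  ∫ s, K (p.1, (p.2, s)) * u s

theorem measurable_contraction (K : e.L2Sigma) (u : L2R d) : Measurable (e.contraction K u) := by
  have hK : Measurable K := (Lp.stronglyMeasurable K).measurable
  have hu : Measurable u := (Lp.stronglyMeasurable u).measurable
  refine (StronglyMeasurable.integral_prod_right'
    (f := fun r : ((Fin m → ℝ) × (Fin d → ℝ)) × (Fin d → ℝ) =>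
      K (r.1.1, (r.1.2, r.2)) * u r.2) ?_).measurable
  refine ((hK.comp ?_).mul (hu.comp measurable_snd)).stronglyMeasurable
  exact measurable_fst.fst.prodMk (measurable_fst.snd.prodMk measurable_snd)

/-- Cauchy-Schwarz in s against the unit vector u, for each (ℓ, t). -/
theorem lintegral_contraction_le (K : e.L2Sigma) {u : L2R d} (hu : ‖u‖ = 1) :
    ∫⁻ ℓ, ∫⁻ t, ‖e.contraction K u (ℓ, t)‖ₑ ^ 2 ∂volume ∂e.plancherelMeasure ≤ ‖K‖ₑ ^ 2 := by
  have hK : Measurable K := (Lp.stronglyMeasurable K).measurable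
  have hKm : Measurable fun p => ‖K p‖ₑ ^ 2 := hK.enorm.pow_const _
  rw [Lp.enorm_def, ← lintegral_enorm_sq_eq, lintegral_prod _ hKm.aemeasurable]
  refine lintegral_mono fun ℓ => ?_
  have h1 : ∫⁻ p : Plane d, ‖K (ℓ, p)‖ₑ ^ 2 = ∫⁻ t, ∫⁻ s, ‖K (ℓ, (t, s))‖ₑ ^ 2 :=
    lintegral_prod _ (hKm.comp measurable_prodMk_left).aemeasurable
  rw [h1]
  refine lintegral_mono fun t => ?_
  have h2 := enorm_integral_mul_sq_le (μ := (volume : Measure (Fin d → ℝ)))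
    (f := fun s => K (ℓ, (t, s))) (g := u)
    (hK.comp (measurable_const.prodMk measurable_prodMk_left)).aestronglyMeasurable
    (Lp.aestronglyMeasurable u)
  rwa [lintegral_enorm_sq_eq_one hu, mul_one] at h2

/-- The matrix coefficient of `kernelAction` against the field of projections onto `u`. -/
def fieldCoeff (I : Set (Fin m → ℝ)) (u : L2R d) (K : e.L2Sigma) (g : Coords m d) : ℂ :=
  ∫ p, (starRingEnd ℂ) (pairChar (e.freqMap (p.1, p.2.1)) (g.1, g.2.1) *
    K (p.1, (p.2.1 - g.2.2, p.2.2))) * projectionField I u p ∂(e.plancherelMeasure.prod volume)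

theorem inner_kernelAction {I : Set (Fin m → ℝ)} {u : L2R d}
    (h : MemLp (projectionField I u) 2 (e.plancherelMeasure.prod volume)) (K : e.L2Sigma)
    (g : Coords m d) : inner ℂ (e.kernelAction g K) (h.toLp _) = e.fieldCoeff I u K g := by
  rw [L2.inner_def, fieldCoeff]
  refine integral_congr_ae ?_
  filter_upwards [h.coeFn_toLp, e.coeFn_kernelAction g K] with p h1 h2
  rw [RCLike.inner_apply, h1, h2, mul_comm]

theorem measurable_fieldCoeff {I : Set (Fin m → ℝ)} (hI : MeasurableSet I) (u : L2R d)
    (K : e.L2Sigma) : Measurable (e.fieldCoeff I u K) := by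
  have hK : Measurable K := (Lp.stronglyMeasurable K).measurable
  refine (StronglyMeasurable.integral_prod_right'
    (f := fun r : Coords m d × ((Fin m → ℝ) × Plane d) =>
    (starRingEnd ℂ) (pairChar (e.freqMap (r.2.1, r.2.2.1)) (r.1.1, r.1.2.1) *
      K (r.2.1, (r.2.2.1 - r.1.2.2, r.2.2.2))) * projectionField I u r.2) ?_).measurable
  refine (Measurable.mul (Complex.continuous_conj.measurable.comp (Measurable.mul ?_ ?_))
    ((measurable_projectionField hI u).comp measurable_snd)).stronglyMeasurable
  · exact measurable_pairChar_comp
      (e.measurable_freqMap.comp (measurable_snd.fst.prodMk measurable_snd.snd.fst))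
      (measurable_fst.fst.prodMk measurable_fst.snd.fst)
  · exact hK.comp (measurable_snd.fst.prodMk
      ((measurable_snd.snd.fst.sub measurable_fst.snd.snd).prodMk measurable_snd.snd.snd))

/-- For fixed `x`, the coefficient `(z, y) ↦ fieldCoeff (z, y, x)` is, up to conjugation, the
Fourier integral of this function in the variables `(ℓ, t)`. -/
def coeffDensity (I : Set (Fin m → ℝ)) (u : L2R d) (K : e.L2Sigma) (x : Fin d → ℝ)
    (p : (Fin m → ℝ) × (Fin d → ℝ)) : ℂ :=
  I.indicator (fun _ => (1 : ℂ)) p.1 * (starRingEnd ℂ) (u p.2) *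
    e.contraction K u (p.1, p.2 - x)

theorem measurable_coeffDensity {I : Set (Fin m → ℝ)} (hI : MeasurableSet I) (u : L2R d)
    (K : e.L2Sigma) : Measurable fun r : (Fin d → ℝ) × ((Fin m → ℝ) × (Fin d → ℝ)) =>
      e.coeffDensity I u K r.1 r.2 := by
  have hu : Measurable u := (Lp.stronglyMeasurable u).measurable
  have h1 : Measurable (I.indicator fun _ => (1 : ℂ)) := measurable_const.indicator hI
  refine Measurable.mul (Measurable.mul (h1.comp measurable_snd.fst) ?_) ?_
  · exact Complex.continuous_conj.measurable.comp (hu.comp measurable_snd.snd)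
  · exact (e.measurable_contraction K u).comp
      (measurable_snd.fst.prodMk (measurable_snd.snd.sub measurable_fst))

/-- A product of two L² functions: 1_I ⊗ conj u, by finiteness of μ(I), and a translate of the
contraction. -/
theorem integrable_coeffDensity {I : Set (Fin m → ℝ)} (hI : MeasurableSet I)
    (hI' : e.plancherelMeasure I < ⊤) {u : L2R d} (hu : ‖u‖ = 1) (K : e.L2Sigma)
    (x : Fin d → ℝ) :
    Integrable (e.coeffDensity I u K x) (e.plancherelMeasure.prod volume) := by
  have hum : Measurable u := (Lp.stronglyMeasurable u).measurable
  have h1 : Measurable (I.indicator fun _ => (1 : ℂ)) := measurable_const.indicator hI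
  have hA : MemLp (fun p : (Fin m → ℝ) × (Fin d → ℝ) =>
      I.indicator (fun _ => (1 : ℂ)) p.1 * (starRingEnd ℂ) (u p.2)) 2
      (e.plancherelMeasure.prod volume) := by
    have hm : Measurable (fun p : (Fin m → ℝ) × (Fin d → ℝ) =>
        I.indicator (fun _ => (1 : ℂ)) p.1 * (starRingEnd ℂ) (u p.2)) :=
      (h1.comp measurable_fst).mul
        (Complex.continuous_conj.measurable.comp (hum.comp measurable_snd))
    rw [memLp_two_iff_integrable_sq_norm hm.aestronglyMeasurable]
    have i1 : Integrable (I.indicator fun _ => (1 : ℝ)) e.plancherelMeasure :=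
      (integrable_indicator_iff hI).2 (integrableOn_const hI'.ne)
    have i2 := (memLp_two_iff_integrable_sq_norm (Lp.aestronglyMeasurable u)).1 (Lp.memLp u)
    refine (i1.mul_prod i2).congr (Filter.Eventually.of_forall fun p => ?_)
    by_cases hp : p.1 ∈ I <;> simp [hp]
  have hB : MemLp (e.contraction K u) 2 (e.plancherelMeasure.prod volume) := by
    refine ⟨(e.measurable_contraction K u).aestronglyMeasurable, ?_⟩
    have h := e.lintegral_contraction_le K hu
    rw [← lintegral_prod _
      ((e.measurable_contraction K u).enorm.pow_const _).aemeasurable,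
      lintegral_enorm_sq_eq] at h
    by_contra h3
    rw [not_lt_top_iff.1 h3] at h
    have h4 : ‖K‖ₑ ^ 2 < ⊤ := ENNReal.pow_lt_top enorm_lt_top
    simp only [ne_eq, OfNat.ofNat_ne_zero, not_false_eq_true, ENNReal.top_pow] at h
    exact absurd h4 (not_lt.2 h)
  have mp : MeasurePreserving (fun p : (Fin m → ℝ) × (Fin d → ℝ) => (p.1, p.2 - x))
      (e.plancherelMeasure.prod volume) (e.plancherelMeasure.prod volume) :=
    (MeasurePreserving.id _).prod (measurePreserving_sub_right volume x)
  exact hA.integrable_mul (hB.comp_measurePreserving mp)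

/-- For fixed (ℓ, t) the substitution x ↦ t - x separates the variables; the factor |u(t)|² then
integrates to 1 and the contraction remains. -/
theorem lintegral_coeffDensity_le {I : Set (Fin m → ℝ)} (hI : MeasurableSet I)
    {u : L2R d} (hu : ‖u‖ = 1) (K : e.L2Sigma) :
    ∫⁻ x, ∫⁻ p, ‖e.coeffDensity I u K x p‖ₑ ^ 2 ∂(e.plancherelMeasure.prod volume) ≤
      ‖K‖ₑ ^ 2 := by
  have hm := (e.measurable_coeffDensity hI u K).enorm.pow_const 2
  rw [lintegral_lintegral_swap hm.aemeasurable, lintegral_prod]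
  swap
  · exact (Measurable.lintegral_prod_left' hm).aemeasurable
  refine (lintegral_mono fun ℓ => ?_).trans (e.lintegral_contraction_le K hu)
  have h1 : ∀ t, ∫⁻ x, ‖e.coeffDensity I u K x (ℓ, t)‖ₑ ^ 2 ≤
      ‖u t‖ₑ ^ 2 * ∫⁻ x, ‖e.contraction K u (ℓ, x)‖ₑ ^ 2 := fun t => by
    rw [← lintegral_sub_left_eq_self (fun x => ‖e.contraction K u (ℓ, x)‖ₑ ^ 2) t,
      ← lintegral_const_mul]
    · refine lintegral_mono fun x => ?_
      by_cases hp : ℓ ∈ I <;> simp [coeffDensity, hp, mul_pow]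
    · exact ((e.measurable_contraction K u).comp
        (measurable_const.prodMk (measurable_const.sub measurable_id))).enorm.pow_const _
  refine (lintegral_mono h1).trans_eq ?_
  rw [lintegral_mul_const'' _ ((Lp.aestronglyMeasurable u).enorm.pow_const _),
    lintegral_enorm_sq_eq_one hu, one_mul]

end AdaptedBasis

theorem pairChar_comm {m d : ℕ} (w p : (Fin m → ℝ) × (Fin d → ℝ)) :
    pairChar w p = pairChar p w := by
  rw [pairChar, pairChar, dotProduct_comm w.1, dotProduct_comm w.2]

namespace AdaptedBasis

variable {𝔫 : Type*} [LieRing 𝔫] [LieAlgebra ℝ 𝔫] {m d : ℕ} (e : AdaptedBasis 𝔫 m d)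

theorem integrable_fieldCoeff_integrand {I : Set (Fin m → ℝ)} {u : L2R d}
    (h : MemLp (projectionField I u) 2 (e.plancherelMeasure.prod volume)) (K : e.L2Sigma)
    (g : Coords m d) : Integrable (fun p => (starRingEnd ℂ) (pairChar (e.freqMap (p.1, p.2.1))
      (g.1, g.2.1) * K (p.1, (p.2.1 - g.2.2, p.2.2))) * projectionField I u p)
      (e.plancherelMeasure.prod volume) :=
  MemLp.integrable_mul (memLp_twist (e.measurable_pairChar_freqMap g)
    (fun _ => norm_pairChar _ _) (e.measurePreserving_kernelShift g.2.2) K).star h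

/-- The variable s enters only through K and u, so integrating it out leaves the contraction;
conjugation gives the character its positive exponent. -/
theorem conj_fieldCoeff {I : Set (Fin m → ℝ)} {u : L2R d}
    (h : MemLp (projectionField I u) 2 (e.plancherelMeasure.prod volume)) (K : e.L2Sigma)
    (g : Coords m d) : (starRingEnd ℂ) (e.fieldCoeff I u K g) =
      ∫ p : (Fin m → ℝ) × (Fin d → ℝ), pairChar (e.freqMap p) (g.1, g.2.1) *
        e.coeffDensity I u K g.2.2 p ∂(e.plancherelMeasure.prod volume) := by
  have hi := e.integrable_fieldCoeff_integrand h K g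
  have mp := measurePreserving_prodAssoc e.plancherelMeasure (volume : Measure (Fin d → ℝ))
    (volume : Measure (Fin d → ℝ))
  have hi' := (mp.integrable_comp_emb (MeasurableEquiv.measurableEmbedding _)).2 hi
  have h1 : e.fieldCoeff I u K g = _ :=
    (mp.integral_comp (MeasurableEquiv.measurableEmbedding _) _).symm.trans
      (integral_prod _ hi')
  rw [h1, ← integral_conj]
  refine integral_congr_ae (Filter.Eventually.of_forall fun p => ?_)
  simp only [coeffDensity, contraction]
  rw [← integral_conj, ← integral_const_mul, ← integral_const_mul]
  refine integral_congr_ae (Filter.Eventually.of_forall fun s => ?_)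
  simp only [MeasurableEquiv.prodAssoc, MeasurableEquiv.coe_mk,
    Equiv.prodAssoc_apply, projectionField, map_mul, Complex.conj_conj]
  by_cases hp : p.1 ∈ I
  · simp only [hp, Set.indicator_of_mem, map_one]
    ring
  · simp [hp]

section TwoStep

variable [TwoStepLie 𝔫]

/-- Substituting ξ = B(ℓ)ᵀt replaces μ by Lebesgue measure, and the symmetry of `pairChar` lets (z,
y) play the part of the frequency. -/
theorem conj_fieldCoeff_eq_charIntegral {I : Set (Fin m → ℝ)} (hI : MeasurableSet I) {u : L2R d}
    (h : MemLp (projectionField I u) 2 (e.plancherelMeasure.prod volume)) (K : e.L2Sigma)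
    (g : Coords m d) : (starRingEnd ℂ) (e.fieldCoeff I u K g) =
      charIntegral (e.coeffDensity I u K g.2.2 ∘ e.freqInv) (g.1, g.2.1) := by
  have hD : Measurable (e.coeffDensity I u K g.2.2) :=
    Measurable.of_uncurry_left (f := e.coeffDensity I u K) (e.measurable_coeffDensity hI u K)
  have hP : Measurable fun p : (Fin m → ℝ) × (Fin d → ℝ) =>
      pairChar (e.freqMap p) (g.1, g.2.1) :=
    measurable_pairChar_comp e.measurable_freqMap measurable_const
  have hPD : Measurable fun p : (Fin m → ℝ) × (Fin d → ℝ) =>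
      pairChar (e.freqMap p) (g.1, g.2.1) * e.coeffDensity I u K g.2.2 p := hP.mul hD
  have key := e.measurePreserving_freqInv.integral_comp_of_aestronglyMeasurable
    hPD.aestronglyMeasurable
  rw [e.conj_fieldCoeff h K g, ← key]
  refine integral_congr_ae ?_
  have hae : ∀ᵐ w : (Fin m → ℝ) × (Fin d → ℝ), w.1 ∈ e.crossSection :=
    Measure.quasiMeasurePreserving_fst.ae e.ae_mem_crossSection
  filter_upwards [hae] with w hw
  simp only [Function.comp_apply]
  rw [e.freqMap_freqInv hw, pairChar_comm]

/-- The matrix coefficients of the left regular representation against the field of projections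
are square integrable on the group. -/
theorem lintegral_fieldCoeff_le {I : Set (Fin m → ℝ)} (hI : MeasurableSet I)
    (hI' : e.plancherelMeasure I < ⊤) {u : L2R d} (hu : ‖u‖ = 1) (K : e.L2Sigma) :
    ∫⁻ g, ‖e.fieldCoeff I u K g‖ₑ ^ 2 ≤ ‖K‖ₑ ^ 2 := by
  have h := e.memLp_projectionField hI hI' hu
  have hm : Measurable fun g => ‖e.fieldCoeff I u K g‖ₑ ^ 2 :=
    (e.measurable_fieldCoeff hI u K).enorm.pow_const 2
  have mp := measurePreserving_prodAssoc (volume : Measure (Fin m → ℝ))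
    (volume : Measure (Fin d → ℝ)) (volume : Measure (Fin d → ℝ))
  refine (mp.lintegral_comp hm).symm.trans_le ?_
  refine (lintegral_prod_symm _ (hm.comp mp.measurable).aemeasurable).trans_le ?_
  refine (lintegral_mono fun x => ?_).trans (e.lintegral_coeffDensity_le hI hu K)
  have hi : Integrable (e.coeffDensity I u K x ∘ e.freqInv) :=
    e.measurePreserving_freqInv.integrable_comp_of_integrable
      (e.integrable_coeffDensity hI hI' hu K x)
  have hmD : Measurable fun p => ‖e.coeffDensity I u K x p‖ₑ ^ 2 :=
    ((e.measurable_coeffDensity hI u K).comp measurable_prodMk_left).enorm.pow_const 2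
  -- Parseval in (z, y) for each x. The inequality suffices, and needs only integrability of the
  -- density, which is what is known for every x.
  refine Eq.trans_le ?_ ((lintegral_charIntegral_enorm_sq_le hi).trans_eq
    (e.measurePreserving_freqInv.lintegral_comp hmD))
  refine lintegral_congr fun v => ?_
  change ‖e.fieldCoeff I u K (v.1, (v.2, x))‖ₑ ^ 2 = _
  rw [← RCLike.enorm_conj, e.conj_fieldCoeff_eq_charIntegral hI h]

end TwoStep

/-! ### Tiling by the quasi-lattice -/

/-- The coordinates of a point of the quasi-lattice. -/
def latticePoint (a : Fin m → ℝ) (q b : Fin d → ℝ)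
    (γ : (Fin m → ℤ) × (Fin d → ℤ) × (Fin d → ℤ)) : Coords m d :=
  (fun j => γ.1 j / a j, fun j => γ.2.1 j / q j, fun j => γ.2.2 j / b j)

/-- The box `∏ [0, 1/a_k) × ∏ [0, 1/q_j) × ∏ [0, 1/b_j)`. -/
def fundamentalBox (a : Fin m → ℝ) (q b : Fin d → ℝ) : Set (Coords m d) :=
  (Set.univ.pi fun k => Set.Ico 0 (1 / a k)) ×ˢ
    ((Set.univ.pi fun k => Set.Ico 0 (1 / q k)) ×ˢ (Set.univ.pi fun k => Set.Ico 0 (1 / b k)))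

theorem volume_fundamentalBox (a : Fin m → ℝ) (q b : Fin d → ℝ)
    (ha : ∀ k, 0 < a k) (hq : ∀ j, 0 < q j) (hb : ∀ j, 0 < b j) :
    volume (fundamentalBox a q b) =
      (ENNReal.ofReal ((∏ j, q j) * (∏ j, b j) * (∏ k, a k)))⁻¹ := by
  have key : ∀ {n : ℕ} (c : Fin n → ℝ), (∀ k, 0 < c k) →
      volume (Set.univ.pi fun k => Set.Ico 0 (1 / c k)) = (ENNReal.ofReal (∏ k, c k))⁻¹ := by
    intro n c hc
    rw [Real.volume_pi_Ico, ← ENNReal.ofReal_prod_of_nonneg,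
      ← ENNReal.ofReal_inv_of_pos (Finset.prod_pos fun k _ => hc k)]
    · simp
    · intro k _
      simpa using (hc k).le
  have hpos : ∀ {n : ℕ} (c : Fin n → ℝ), (∀ k, 0 < c k) → 0 < ∏ k, c k :=
    fun c hc => Finset.prod_pos fun k _ => hc k
  rw [fundamentalBox, Measure.volume_eq_prod, Measure.prod_prod, Measure.volume_eq_prod,
    Measure.prod_prod, key a ha, key q hq, key b hb, ← ENNReal.ofReal_inv_of_pos (hpos a ha),
    ← ENNReal.ofReal_inv_of_pos (hpos q hq), ← ENNReal.ofReal_inv_of_pos (hpos b hb),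
    ← ENNReal.ofReal_mul (inv_nonneg.2 (hpos q hq).le),
    ← ENNReal.ofReal_mul (inv_nonneg.2 (hpos a ha).le),
    ← ENNReal.ofReal_inv_of_pos (mul_pos (mul_pos (hpos q hq) (hpos b hb)) (hpos a ha))]
  congr 1
  rw [_root_.mul_inv_rev, _root_.mul_inv_rev, mul_comm (∏ k, q k)⁻¹]

/-- Right translation by `g` in coordinates. -/
def rightShift (g p : Coords m d) : Coords m d :=
  (g.1 + (p.1 + e.zRepr ⁅e.xVec p.2.2, e.yVec g.2.1⁆), g.2.1 + p.2.1, g.2.2 + p.2.2)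

theorem measurable_zRepr_lie_lie : Measurable fun p : (Fin d → ℝ) × (Fin d → ℝ) =>
    e.zRepr ⁅e.xVec p.1, e.yVec p.2⁆ := by
  refine measurable_pi_lambda _ fun k => ?_
  simp only [zRepr, xVec, yVec, lie_sum, lie_smul, sum_lie, smul_lie, map_sum, map_smul,
    Finsupp.coe_finsetSum, Finset.sum_apply, Finsupp.smul_apply, smul_eq_mul]
  fun_prop

/-- Given (y, x), the z-coordinate is merely translated, by an amount depending on x alone: right
translations preserve the same measure as left ones. -/
theorem measurePreserving_rightShift (g : Coords m d) :
    MeasurePreserving (e.rightShift g) volume volume := by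
  have hb : MeasurePreserving (fun r : (Fin d → ℝ) × (Fin d → ℝ) => (g.2.1 + r.1, g.2.2 + r.2))
      volume volume :=
    (measurePreserving_add_left volume g.2.1).prod (measurePreserving_add_left volume g.2.2)
  have hm : Measurable fun x : Fin d → ℝ => e.zRepr ⁅e.xVec x, e.yVec g.2.1⁆ :=
    e.measurable_zRepr_lie_lie.comp measurable_prodMk_right
  have h := MeasurePreserving.skew_product (μa := (volume : Measure ((Fin d → ℝ) × (Fin d → ℝ))))
    (μb := volume) (μc := (volume : Measure (Fin m → ℝ))) (μd := volume) hb
    (g := fun r z => g.1 + (z + e.zRepr ⁅e.xVec r.2, e.yVec g.2.1⁆))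
    (measurable_const.add (measurable_snd.add (hm.comp measurable_fst.snd)))
    (Filter.Eventually.of_forall fun r =>
      ((measurePreserving_add_left volume g.1).comp (measurePreserving_add_right volume _)).map_eq)
  exact (Measure.measurePreserving_swap.comp h).comp Measure.measurePreserving_swap

/-- `⌊c x⌋`, entry by entry. -/
def floorVec {n : ℕ} (c x : Fin n → ℝ) (k : Fin n) : ℤ := ⌊c k * x k⌋

theorem measurable_floorVec {n : ℕ} (c : Fin n → ℝ) : Measurable (floorVec c) := by
  unfold floorVec
  fun_prop

theorem floorVec_div_add {n : ℕ} {c x : Fin n → ℝ} (hc : ∀ k, 0 < c k)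
    (hx : x ∈ Set.univ.pi fun k => Set.Ico 0 (1 / c k)) (i : Fin n → ℤ) :
    floorVec c ((fun k => i k / c k) + x) = i := by
  funext k
  have h1 := (hx k (Set.mem_univ k))
  have h2 : ⌊c k * x k⌋ = 0 := by
    rw [Int.floor_eq_zero_iff]
    exact ⟨mul_nonneg (hc k).le h1.1, by
      have := (lt_div_iff₀ (hc k)).1 h1.2
      linarith [mul_comm (c k) (x k)]⟩
  rw [floorVec, Pi.add_apply, mul_add, mul_div_cancel₀ _ (hc k).ne', Int.floor_intCast_add, h2,
    add_zero]

/-- The index of the translate of `fundamentalBox` that contains a point. -/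
def cellIndex (a : Fin m → ℝ) (q b : Fin d → ℝ) (p : Coords m d) :
    (Fin m → ℤ) × (Fin d → ℤ) × (Fin d → ℤ) :=
  (floorVec a (p.1 - e.zRepr ⁅e.xVec (p.2.2 - fun j => floorVec b p.2.2 j / b j),
    e.yVec fun j => floorVec q p.2.1 j / q j⁆), floorVec q p.2.1, floorVec b p.2.2)

theorem measurable_cellIndex (a : Fin m → ℝ) (q b : Fin d → ℝ) :
    Measurable (e.cellIndex a q b) := by
  have hdiv : ∀ c : Fin d → ℝ, Measurable fun (x : Fin d → ℝ) (j : Fin d) =>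
      (floorVec c x j : ℝ) / c j := fun c => measurable_pi_lambda _ fun j =>
    (((measurable_of_countable (fun i : ℤ => (i : ℝ))).comp
      ((measurable_pi_apply j).comp (measurable_floorVec c)))).div_const _
  refine ((measurable_floorVec a).comp (measurable_fst.sub (e.measurable_zRepr_lie_lie.comp
    (Measurable.prodMk (measurable_snd.snd.sub ((hdiv b).comp measurable_snd.snd))
      ((hdiv q).comp measurable_snd.fst))))).prodMk
    (((measurable_floorVec q).comp measurable_snd.fst).prodMk
      ((measurable_floorVec b).comp measurable_snd.snd))

/-- The y- and x-coordinates add, so their floors recover two of the indices and the position of x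
in the box. These determine the commutator term in z, and once it is subtracted a floor recovers the
last index. -/
theorem cellIndex_rightShift {a : Fin m → ℝ} {q b : Fin d → ℝ}
    (ha : ∀ k, 0 < a k) (hq : ∀ j, 0 < q j) (hb : ∀ j, 0 < b j)
    (γ : (Fin m → ℤ) × (Fin d → ℤ) × (Fin d → ℤ)) {p : Coords m d}
    (hp : p ∈ fundamentalBox a q b) :
    e.cellIndex a q b (e.rightShift (latticePoint a q b γ) p) = γ := by
  obtain ⟨h1, h2, h3⟩ := hp
  have e2 := floorVec_div_add hq h2 γ.2.1
  have e3 := floorVec_div_add hb h3 γ.2.2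
  simp only [cellIndex, rightShift, latticePoint, e2, e3, add_sub_cancel_left]
  rw [← add_assoc, add_sub_cancel_right, floorVec_div_add ha h1]

/-- The translates of `fundamentalBox` by the quasi-lattice do not overlap. -/
theorem tsum_setLIntegral_rightShift_le {a : Fin m → ℝ} {q b : Fin d → ℝ}
    (ha : ∀ k, 0 < a k) (hq : ∀ j, 0 < q j) (hb : ∀ j, 0 < b j) {G : Coords m d → ℝ≥0∞}
    (hG : Measurable G) :
    ∑' γ, ∫⁻ p in fundamentalBox a q b, G (e.rightShift (latticePoint a q b γ) p) ≤
      ∫⁻ p, G p := by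
  have hc : ∀ γ, MeasurableSet (e.cellIndex a q b ⁻¹' {γ}) := fun γ =>
    e.measurable_cellIndex a q b (measurableSet_singleton γ)
  calc ∑' γ, ∫⁻ p in fundamentalBox a q b, G (e.rightShift (latticePoint a q b γ) p)
      ≤ ∑' γ, ∫⁻ p in e.cellIndex a q b ⁻¹' {γ}, G p := by
        refine ENNReal.tsum_le_tsum fun γ => ?_
        rw [← (e.measurePreserving_rightShift (latticePoint a q b γ)).setLIntegral_comp_preimage
          (hc γ) hG]
        exact lintegral_mono_set fun p hp => e.cellIndex_rightShift ha hq hb γ hp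
    _ = ∫⁻ p in ⋃ γ, e.cellIndex a q b ⁻¹' {γ}, G p :=
        (lintegral_iUnion hc (fun γ γ' h => Disjoint.preimage _ (by simpa using h)) _).symm
    _ ≤ ∫⁻ p, G p := setLIntegral_le_lintegral _ _

theorem ofCoords_latticePoint_mem (a : Fin m → ℝ) (q b : Fin d → ℝ)
    (γ : (Fin m → ℤ) × (Fin d → ℤ) × (Fin d → ℤ)) :
    e.ofCoords (latticePoint a q b γ) ∈ e.quasiLattice a q b :=
  ⟨γ.1, γ.2.1, γ.2.2, rfl⟩

theorem surjective_latticePoint (a : Fin m → ℝ) (q b : Fin d → ℝ) :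
    Function.Surjective fun γ => (⟨e.ofCoords (latticePoint a q b γ),
      e.ofCoords_latticePoint_mem a q b γ⟩ : e.quasiLattice a q b) := by
  rintro ⟨_, i, k, n, rfl⟩
  exact ⟨(i, k, n), rfl⟩

section TwoStep

variable [TwoStepLie 𝔫]

theorem leftRegular_one_apply (f : e.L2N) : e.leftRegular 1 f = f := by
  refine Lp.ext ?_
  filter_upwards [e.coeFn_leftRegular 1 f] with n hn
  rw [hn, inv_one, one_mul]

theorem ofCoords_mul_ofCoords (p g : Coords m d) :
    e.ofCoords p * e.ofCoords g = e.ofCoords (e.rightShift g p) := by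
  rw [ofCoords_mul, rightShift, add_left_comm, ← add_assoc p.1]

end TwoStep

end AdaptedBasis

/-! ### Parseval frames and the bound on μ(I) -/

/-- The vectors of a Parseval frame have norm at most one. -/
theorem norm_le_one_of_isParsevalFrame {E ι : Type*} [NormedAddCommGroup E]
    [InnerProductSpace ℂ E] {H : Submodule ℂ E} {f : ι → E} (h : IsParsevalFrame H f) (i : ι) :
    ‖f i‖ ≤ 1 := by
  -- One term of the frame identity for the vector f_i itself: ‖f_i‖⁴ ≤ ‖f_i‖².
  have h1 := le_hasSum (h.2 (f i) (h.1 i)) i fun j _ => sq_nonneg _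
  rw [inner_self_eq_norm_sq_to_K] at h1
  have h2 : ‖((‖f i‖ : ℂ) ^ 2)‖ = ‖f i‖ ^ 2 := by simp
  simp only [Complex.coe_algebraMap, h2] at h1
  by_contra h3
  nlinarith [norm_nonneg (f i), mul_pos (sub_pos.2 (not_le.1 h3)) (sub_pos.2 (not_le.1 h3)),
    sq_nonneg (‖f i‖ ^ 2 - 1)]


theorem mainTheorem7 {𝔫 : Type*} [LieRing 𝔫] [LieAlgebra ℝ 𝔫] [TwoStepLie 𝔫] {m d : ℕ}
    (hd : 1 ≤ d) (e : AdaptedBasis 𝔫 m d)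
    (a : Fin m → ℝ) (q b : Fin d → ℝ)
    (ha : ∀ k, 0 < a k) (hq : ∀ j, 0 < q j) (hb : ∀ j, 0 < b j)
    (I : Set (Fin m → ℝ)) (hI : MeasurableSet I)
    (hIS : I ⊆ e.crossSection) (hIa : ∀ ℓ ∈ I, ∀ k, 0 ≤ ℓ k ∧ ℓ k ≤ a k)
    (u : AdaptedBasis.L2R d) (hu : ‖u‖ = 1)
    (hη : ∃ η : e.L2N, IsParsevalFrame (e.bandLimitedSpace I u)
      (fun γ : e.quasiLattice a q b => e.leftRegular γ η)) :
    e.plancherelMeasure I ≤ ENNReal.ofReal ((∏ j, q j) * (∏ j, b j) * (∏ k, a k)) := by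
  obtain ⟨η, hη⟩ := hη
  -- The box containing I makes μ(I) finite, which puts the projection field in L².
  have hfin : e.plancherelMeasure I < ⊤ := e.plancherelMeasure_lt_top (c := a)
    fun ℓ hℓ => ⟨fun k => (hIa ℓ hℓ k).1, fun k => (hIa ℓ hℓ k).2⟩
  have hP := e.memLp_projectionField hI hfin hu
  obtain ⟨ψ, hψ⟩ := e.exists_mem_plancherelGraph (hP.toLp _)
  have hψH : ψ ∈ e.bandLimitedSpace I u :=
    ⟨(ψ, hP.toLp _), ⟨hψ, e.toLp_projectionField_mem_rankOneField hP⟩, rfl⟩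
  have hψn : ‖ψ‖ₑ ^ 2 = e.plancherelMeasure I := by
    have h1 := e.norm_eq_of_mem_plancherelGraph hψ
    simp only at h1
    rw [← e.lintegral_projectionField hI hu, lintegral_enorm_sq_eq,
      ← eLpNorm_congr_ae hP.coeFn_toLp, ← Lp.enorm_def, ← ofReal_norm, ← ofReal_norm, h1]
  obtain ⟨K, hK⟩ : ∃ K, (η, K) ∈ e.plancherelGraph := by
    -- Any lattice point would do: translating L(γ)η back by γ⁻¹ stays in the invariant space 𝓗, so
    -- η has a Plancherel transform.
    set γ : e.quasiLattice a q b := ⟨_, e.ofCoords_latticePoint_mem a q b 0⟩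
    obtain ⟨x, ⟨hx, _⟩, hx1⟩ := e.leftRegular_mem_bandLimitedSpace (γ : NilGroup 𝔫)⁻¹ (hη.1 γ)
    rw [← e.leftRegular_mul_apply, inv_mul_cancel, e.leftRegular_one_apply] at hx1
    exact ⟨x.2, hx1 ▸ hx⟩
  have hη1 : ‖K‖ₑ ^ 2 ≤ 1 := by
    have h1 := norm_le_one_of_isParsevalFrame hη
      ⟨_, e.ofCoords_latticePoint_mem a q b 0⟩
    rw [LinearIsometry.norm_map] at h1
    have h2 := e.norm_eq_of_mem_plancherelGraph hK
    simp only at h2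
    rw [← ofReal_norm, h2]
    exact pow_le_one₀ zero_le (ENNReal.ofReal_le_one.2 h1)
  -- Unitarity of L(p) moves p to the other side, so the coefficient is that of L(pγ)η against ψ;
  -- Plancherel then transfers it to the kernel fields.
  have hcoeff : ∀ p γ, inner ℂ (e.leftRegular (e.ofCoords (AdaptedBasis.latticePoint a q b γ)) η)
      (e.leftRegular (e.ofCoords p)⁻¹ ψ) =
        e.fieldCoeff I u K (e.rightShift (AdaptedBasis.latticePoint a q b γ) p) := fun p γ => by
    rw [← e.inner_kernelAction hP, ← (e.leftRegular (e.ofCoords p)).inner_map_map,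
      ← e.leftRegular_mul_apply, ← e.leftRegular_mul_apply, mul_inv_cancel,
      e.leftRegular_one_apply, e.ofCoords_mul_ofCoords]
    exact (e.inner_eq_of_mem_plancherelGraph (e.leftRegular_mem_plancherelGraph
      (e.rightShift (AdaptedBasis.latticePoint a q b γ) p) hK) hψ).symm
  have hsum : ∀ p, e.plancherelMeasure I ≤ ∑' γ,
      ‖e.fieldCoeff I u K (e.rightShift (AdaptedBasis.latticePoint a q b γ) p)‖ₑ ^ 2 := by
    intro p
    have hx := e.leftRegular_mem_bandLimitedSpace (e.ofCoords p)⁻¹ hψH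
    have h1 := hη.2 _ hx
    rw [LinearIsometry.norm_map] at h1
    have h2 := ENNReal.ofReal_tsum_of_nonneg (fun γ => sq_nonneg _) h1.summable
    rw [h1.tsum_eq, ENNReal.ofReal_pow (norm_nonneg _), ofReal_norm, hψn] at h2
    rw [h2]
    -- The frame is indexed by the set Γ and the tiling by integer vectors; surjectivity of the
    -- parametrization gives the direction of inequality that is needed.
    refine (ENNReal.tsum_le_tsum_comp_of_surjective (e.surjective_latticePoint a q b) _).trans_eq ?_
    refine tsum_congr fun γ => ?_
    rw [← hcoeff, ENNReal.ofReal_pow (norm_nonneg _), ofReal_norm]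
  have hm : Measurable fun g => ‖e.fieldCoeff I u K g‖ₑ ^ 2 :=
    (e.measurable_fieldCoeff hI u K).enorm.pow_const 2
  -- Integrating the lower bound over the box unfolds the sum over Γ into at most one integral over
  -- the group.
  have hfinal : e.plancherelMeasure I * volume (AdaptedBasis.fundamentalBox a q b) ≤ 1 := by
    rw [← setLIntegral_const]
    refine (lintegral_mono hsum).trans ?_
    have hm' : ∀ γ, Measurable fun p =>
        ‖e.fieldCoeff I u K (e.rightShift (AdaptedBasis.latticePoint a q b γ) p)‖ₑ ^ 2 :=
      fun γ => hm.comp (e.measurePreserving_rightShift _).measurable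
    rw [lintegral_tsum fun γ => (hm' γ).aemeasurable]
    exact (e.tsum_setLIntegral_rightShift_le ha hq hb hm).trans
      ((e.lintegral_fieldCoeff_le hI hfin hu K).trans hη1)
  rw [AdaptedBasis.volume_fundamentalBox a q b ha hq hb, ← div_eq_mul_inv] at hfinal
  refine (ENNReal.div_le_iff_le_mul (Or.inr (by simp)) (Or.inl ENNReal.ofReal_ne_top)).1
    hfinal |>.trans_eq (one_mul _)

end
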